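/- Let $\chi$ be a real primitive Dirichlet character modulo $q$, $\chi$ nonprincipal (so $q>1$). For real $s>1$ put $F(s,\chi)=\log L(s,\chi)$, and let $\psi_\chi(s)$ be the sequence $\big(\operatorname{sgn}F^{(k)}(s,\chi)\big)_{k}$ with values in $\{-1,0,1\}$, where two sequences are identified if they agree for all sufficiently large $k$. A nontrivial zero of $L(s,\chi)$ is a zero $\rho$ with $0<\operatorname{Re}\rho<1$, and the Riemann hypothesis for $L(s,\chi)$ is the assertion that every nontrivial zero satisfies $\operatorname{Re}\rho=\tfrac12$. There are integers $C_\chi>1$ and $D_\chi\ge 0$, both effectively computable (each is produced by an algorithm, the same for all such $\chi$, whose input is the list of values $\chi(0),\dots,\chi(q-1)$), with the following properties. (a) If the Riemann hypothesis for $L(s,\chi)$ is true and $L(\tfrac12,\chi)\neq 0$, then $\psi_\chi$ is injective on $[C_\chi,\infty)$. (b) Suppose that $\psi_\chi$ is injective on $[C_\chi,\infty)$. If all nontrivial zeros $\rho$ of $L(s,\chi)$ with $|\operatorname{Im}\rho|\le D_\chi$ lie on the line $\operatorname{Re}s=\tfrac12$, then the Riemann hypothesis for $L(s,\chi)$ is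 true. -/

import Mathlib

open Filter

noncomputable section

/-- The function `F(s, χ) = log L(s, χ)` of a real variable `s > 1`, for a real character `χ`
(for which `L(s, χ)` is real and positive at real `s > 1`). -/
def logL {q : ℕ} [NeZero q] (χ : DirichletCharacter ℂ q) (s : ℝ) : ℝ :=
  Real.log (χ.LFunction (s : ℂ)).re

/-- The sequence `k ↦ sgn F^{(k)}(s, χ)`, modulo equality for all large `k`. -/
def signSeq {q : ℕ} [NeZero q] (χ : DirichletCharacter ℂ q) (s : ℝ) :
    Germ (atTop : Filter ℕ) SignType :=
  ((fun k : ℕ => SignType.sign (iteratedDeriv k (logL χ) s) : ℕ → SignType) :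
    Germ (atTop : Filter ℕ) SignType)

/-- `ρ` is a nontrivial zero of `L(s, χ)`: a zero in the open critical strip. -/
def IsNontrivialZero {q : ℕ} [NeZero q] (χ : DirichletCharacter ℂ q) (ρ : ℂ) : Prop :=
  χ.LFunction ρ = 0 ∧ 0 < ρ.re ∧ ρ.re < 1

/-- The Riemann hypothesis for `L(s, χ)`. -/
def RiemannHypothesisFor {q : ℕ} [NeZero q] (χ : DirichletCharacter ℂ q) : Prop :=
  ∀ ρ : ℂ, IsNontrivialZero χ ρ → ρ.re = 1 / 2

/-- All nontrivial zeros of `L(s, χ)` up to height `T` (real zeros included) lie on the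
critical line. -/
def RiemannHypothesisUpTo {q : ℕ} [NeZero q] (χ : DirichletCharacter ℂ q) (T : ℝ) : Prop :=
  ∀ ρ : ℂ, IsNontrivialZero χ ρ → |ρ.im| ≤ T → ρ.re = 1 / 2

/-- The finite description of a real character modulo `q` that is given to an algorithm: the
list of its values `χ(0), …, χ(q - 1)`, each of which is `-1`, `0` or `1`. -/
def valueTable {q : ℕ} (χ : DirichletCharacter ℂ q) : List ℤ :=
  (List.range q).map fun n => ⌊(χ (n : ZMod q)).re⌋

end

/-! Large derivatives of `log L` at a real `s > 1` see only the zeros nearest to `s`. Suppose these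
are `ρ` and its conjugate, and write `s - ρ = r e^{iθ}`. Splitting off the two linear factors and
applying Cauchy's estimate to the rest gives `F^{(k+1)}(s) = (-1)^k k! r^{-(k+1)} (c cos((k+1)θ) +
o(1))` with `c > 0`. So the sign sequence is essentially a function of the angle `θ`, and two facts
make this precise. Distinct angles in `(0, π/2)` give different sequences, by a mean value argument
(`not_eventually_sign_eq`). Equal angles `πa/b` with `b` odd give equal sequences, because then
`cos((k+1)θ)` stays away from zero (`IsNearestZero.signSeq_eq`).

For (a): under RH, once `s` is large the nearest zeros are the lowest ones, `1/2 ± iγ`. Since `γ ≠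
0`, the angle `arctan(γ/(s - 1/2))` strictly decreases in `s`.

For (b): a zero at `1/2` would keep the angle at `0`, against injectivity, so the lowest zero again
has `γ ≠ 0`. If RH fails, some zero to the right of the line overtakes the lowest zero at a first
point `s₀`, which is large because that zero is high. At `s₀` the two are equally far away but the
new zero has larger real part, so the angle jumps up. An angle `φ = πa/b`, `b` odd, inside the jump
and below the angle at `C` is attained before `s₀` by the lowest zero. It is attained again after
`s₀` by a minimisation argument (`exists_isNearestZero_cos_arg`), and the two equal sequences
contradict injectivity.

Effectivity requires only a bound for the height of the lowest zero
(`exists_isNontrivialZero_norm_lt`). If the centred completed function had no zero in `|w| < n`, it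
would be even there with a holomorphic logarithm of size `O(n log n)`. By Borel–Carathéodory and the
Schwarz lemma it would then be almost constant near `0`, whereas its Gamma factor makes it grow by a
definite ratio. -/

/-! ### Signs of cosine sequences -/

lemma tendsto_mean_cos {φ : ℝ} (h : Complex.exp (φ * Complex.I) ≠ 1) :
    Tendsto (fun n : ℕ => (n : ℝ)⁻¹ * ∑ k ∈ Finset.range n, Real.cos ((k + 1) * φ)) atTop
      (nhds 0) := by
  set z := Complex.exp (φ * Complex.I) with hz
  have hz1 : ‖z‖ = 1 := Complex.norm_exp_ofReal_mul_I φ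
  have hpow : ∀ k : ℕ, Real.cos ((k + 1) * φ) = (z * z ^ k).re := by
    intro k
    rw [← pow_succ', hz, ← Complex.exp_nat_mul]
    rw [show ((k + 1 : ℕ) : ℂ) * (φ * Complex.I) = (((k + 1) * φ : ℝ) : ℂ) * Complex.I by
      push_cast; ring, Complex.exp_ofReal_mul_I_re]
  -- A geometric sum with ratio `z ≠ 1` on the unit circle is bounded independently of `n`.
  have hb : ∀ n : ℕ, |∑ k ∈ Finset.range n, Real.cos ((k + 1) * φ)| ≤ 2 / ‖z - 1‖ := by
    intro n
    have h1 : ∑ k ∈ Finset.range n, Real.cos ((k + 1) * φ)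
        = (z * ((z ^ n - 1) / (z - 1))).re := by
      rw [← geom_sum_eq h, Finset.mul_sum, Complex.re_sum]
      exact Finset.sum_congr rfl fun k _ => hpow k
    rw [h1]
    refine (Complex.abs_re_le_norm _).trans ?_
    rw [norm_mul, hz1, one_mul, norm_div]
    gcongr
    refine (norm_sub_le _ _).trans ?_
    rw [norm_pow, hz1]; norm_num
  refine squeeze_zero_norm (a := fun n : ℕ => (n : ℝ)⁻¹ * (2 / ‖z - 1‖)) (fun n => ?_) ?_
  · rw [norm_mul, Real.norm_eq_abs, Real.norm_eq_abs, abs_of_nonneg (by positivity)]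
    gcongr
    exact hb n
  · simpa using (tendsto_inv_atTop_nhds_zero_nat (𝕜 := ℝ)).mul_const (2 / ‖z - 1‖)

lemma exp_mul_I_ne_one {φ : ℝ} (h0 : φ ≠ 0) (h1 : |φ| < 2 * Real.pi) :
    Complex.exp (φ * Complex.I) ≠ 1 := by
  intro h
  have hc : Real.cos φ = 1 := by
    have := congrArg Complex.re h
    rwa [Complex.exp_ofReal_mul_I_re] at this
  rw [abs_lt] at h1
  exact h0 ((Real.cos_eq_one_iff_of_lt_of_lt h1.1 h1.2).1 hc)

/-- Sequences asymptotic to `c cos ((k + 1) θ)` and `c' cos ((k + 1) θ')` with distinct acute angles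
do not have eventually equal signs. -/
lemma not_eventually_sign_eq {θ θ' c c' : ℝ} {u u' : ℕ → ℝ} (hθ : 0 < θ) (hθ2 : θ < Real.pi / 2)
    (hθ' : 0 < θ') (hθ2' : θ' < Real.pi / 2) (hne : θ ≠ θ') (hc : 0 < c) (hc' : 0 < c')
    (hu : Tendsto (fun k : ℕ => u k - c * Real.cos ((k + 1) * θ)) atTop (nhds 0))
    (hu' : Tendsto (fun k : ℕ => u' k - c' * Real.cos ((k + 1) * θ')) atTop (nhds 0))
    (hs : ∀ᶠ k in atTop, 0 ≤ u k * u' k) : False := by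
  set a : ℕ → ℝ := fun k => Real.cos ((k + 1) * θ) * Real.cos ((k + 1) * θ') with ha
  have ha1 : ∀ k, |a k| ≤ 1 := fun k => by
    rw [ha, abs_mul]
    exact mul_le_one₀ (Real.abs_cos_le_one _) (abs_nonneg _) (Real.abs_cos_le_one _)
  set e : ℕ → ℝ := fun k => (u k * u' k) / (c * c') - a k with he
  have hbd : ∀ (x : ℝ), IsBoundedUnder (· ≤ ·) atTop
      (norm ∘ fun k : ℕ => Real.cos ((k + 1) * x)) := fun x =>
    isBoundedUnder_of ⟨1, fun k => Real.abs_cos_le_one _⟩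
  have he0 : Tendsto e atTop (nhds 0) := by
    have h1 := hu.mul hu'
    have h2 := (hu.zero_mul_isBoundedUnder_le (hbd θ')).const_mul c'
    have h3 := (hu'.zero_mul_isBoundedUnder_le (hbd θ)).const_mul c
    have h4 := ((h1.add h2).add h3).div_const (c * c')
    simp only [mul_zero, add_zero, zero_div] at h4
    refine h4.congr fun k => ?_
    simp only [he, ha]
    field_simp
    ring
  -- Agreement of signs forces `a k ≥ -|e k|`, and `|a k| ≤ 1` gives `a² ≤ |a| ≤ a + 2|e|`. Hence
  -- the means of `a² - a` have no positive limit.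
  have hmax : Tendsto (fun k => max ((a k) ^ 2 - a k) 0) atTop (nhds 0) := by
    have h2 : Tendsto (fun k => 2 * |e k|) atTop (nhds 0) := by
      simpa using he0.abs.const_mul 2
    refine squeeze_zero' (Eventually.of_forall fun k => le_max_right _ _) ?_ h2
    filter_upwards [hs] with k hk
    refine max_le ?_ (by positivity)
    have hp : 0 ≤ e k + a k := by
      simp only [he]; rw [sub_add_cancel]; positivity
    have := ha1 k
    have h5 : (a k) ^ 2 ≤ |a k| := by
      rw [← sq_abs]; nlinarith [abs_nonneg (a k)]
    rcases abs_cases (a k) with h | h <;> rcases abs_cases (e k) with h' | h' <;> linarith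
  have hces := hmax.cesaro
  have m1 := tendsto_mean_cos (exp_mul_I_ne_one (φ := θ - θ') (sub_ne_zero.2 hne)
    (abs_lt.2 ⟨by linarith, by linarith⟩))
  have m2 := tendsto_mean_cos (exp_mul_I_ne_one (φ := θ + θ') (by positivity)
    (abs_lt.2 ⟨by linarith, by linarith⟩))
  have m3 := tendsto_mean_cos (exp_mul_I_ne_one (φ := 2 * θ) (by positivity)
    (abs_lt.2 ⟨by linarith, by linarith⟩))
  have m4 := tendsto_mean_cos (exp_mul_I_ne_one (φ := 2 * θ') (by positivity)
    (abs_lt.2 ⟨by linarith, by linarith⟩))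
  have m5 := tendsto_mean_cos (exp_mul_I_ne_one (φ := 2 * (θ - θ'))
    (mul_ne_zero two_ne_zero (sub_ne_zero.2 hne))
    (abs_lt.2 ⟨by linarith, by linarith⟩))
  have m6 := tendsto_mean_cos (exp_mul_I_ne_one (φ := 2 * (θ + θ')) (by positivity)
    (abs_lt.2 ⟨by linarith, by linarith⟩))
  -- All six frequencies are nonzero and less than `2π` in absolute value, so every cosine averages
  -- to zero. What survives is `1/4`, the mean of `a²`, which contradicts `hmax`.
  have key : ∀ k : ℕ, (a k) ^ 2 - a k = 1 / 4 + (1 / 4) * Real.cos ((k + 1) * (2 * θ))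
      + (1 / 4) * Real.cos ((k + 1) * (2 * θ'))
      + (1 / 8) * Real.cos ((k + 1) * (2 * (θ - θ')))
      + (1 / 8) * Real.cos ((k + 1) * (2 * (θ + θ')))
      - (1 / 2) * Real.cos ((k + 1) * (θ - θ')) - (1 / 2) * Real.cos ((k + 1) * (θ + θ')) := by
    intro k
    simp only [ha]
    set x := (k + 1) * θ with hx
    set y := (k + 1) * θ' with hy
    rw [show (k + 1 : ℝ) * (2 * θ) = 2 * x by rw [hx]; ring,
      show (k + 1 : ℝ) * (2 * θ') = 2 * y by rw [hy]; ring,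
      show (k + 1 : ℝ) * (2 * (θ - θ')) = 2 * x - 2 * y by rw [hx, hy]; ring,
      show (k + 1 : ℝ) * (2 * (θ + θ')) = 2 * x + 2 * y by rw [hx, hy]; ring,
      show (k + 1 : ℝ) * (θ - θ') = x - y by rw [hx, hy]; ring,
      show (k + 1 : ℝ) * (θ + θ') = x + y by rw [hx, hy]; ring,
      Real.cos_sub, Real.cos_add, Real.cos_sub, Real.cos_add, Real.cos_two_mul, Real.cos_two_mul]
    ring
  have hlim : Tendsto (fun n : ℕ => (n : ℝ)⁻¹ * ∑ k ∈ Finset.range n, ((a k) ^ 2 - a k)) atTop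
      (nhds (1 / 4)) := by
    have h := (((((tendsto_const_nhds (x := (1 / 4 : ℝ))).add (m3.const_mul (1 / 4))).add
      (m4.const_mul (1 / 4))).add (m5.const_mul (1 / 8))).add (m6.const_mul (1 / 8))).sub
      (m1.const_mul (1 / 2)) |>.sub (m2.const_mul (1 / 2))
    simp only [mul_zero, add_zero, sub_zero] at h
    refine h.congr' ?_
    filter_upwards [eventually_gt_atTop 0] with n hn
    have hn' : (n : ℝ) ≠ 0 := by positivity
    simp only [key, Finset.sum_sub_distrib, Finset.sum_add_distrib, ← Finset.mul_sum,
      Finset.sum_const, Finset.card_range, nsmul_eq_mul]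
    linear_combination (-(1 / 4)) * inv_mul_cancel₀ hn'
  have := le_of_tendsto_of_tendsto' hlim hces fun n => by
    gcongr
    exact le_max_left _ _
  norm_num at this

/-- For `θ = π a / b` with `b` odd, the numbers `cos (k θ)` are bounded away from zero. -/
lemma exists_le_abs_cos {a b : ℕ} (hb : Odd b) :
    ∃ δ > 0, ∀ k : ℕ, δ ≤ |Real.cos ((k + 1) * (Real.pi * a / b))| := by
  have hb0 : (b : ℝ) ≠ 0 := by
    have := hb.pos
    positivity
  -- A zero of the cosine would make the even number `2ka` equal to a product of two odd numbers.
  have hne : ∀ k : ℕ, Real.cos (k * (Real.pi * a / b)) ≠ 0 := by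
    intro k h
    obtain ⟨n, hn⟩ := Real.cos_eq_zero_iff.1 h
    have h1 : (2 * k * a : ℝ) = (2 * n + 1) * b := by
      field_simp at hn
      linarith
    have h2 : (2 * k * a : ℤ) = (2 * n + 1) * b := by exact_mod_cast h1
    have h3 : Odd ((2 * n + 1) * (b : ℤ)) := (odd_two_mul_add_one n).mul (by exact_mod_cast hb)
    rw [← h2, mul_assoc] at h3
    exact (Int.not_odd_iff_even.2 (even_two_mul _)) h3
  -- The absolute value has period `b` in `k`, so its infimum is a minimum over finitely many
  -- nonzero values.
  have hper : ∀ k : ℕ, |Real.cos (k * (Real.pi * a / b))|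
      = |Real.cos ((k % b : ℕ) * (Real.pi * a / b))| := by
    intro k
    have h : (k : ℝ) * (Real.pi * a / b)
        = (k % b : ℕ) * (Real.pi * a / b) + ((k / b * a : ℕ) : ℝ) * Real.pi := by
      conv_lhs => rw [← Nat.mod_add_div k b]
      push_cast
      field_simp
    rw [h, Real.cos_add_nat_mul_pi, abs_mul, abs_pow, abs_neg, abs_one, one_pow, one_mul]
  have hbp := hb.pos
  obtain ⟨j, -, hj⟩ := Finset.exists_min_image (Finset.range b)
    (fun k : ℕ => |Real.cos (k * (Real.pi * a / b))|) ⟨0, Finset.mem_range.2 hbp⟩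
  refine ⟨_, abs_pos.2 (hne j), fun k => ?_⟩
  have := hj ((k + 1) % b) (Finset.mem_range.2 (Nat.mod_lt _ hbp))
  rw [← hper] at this
  exact_mod_cast this

lemma eventually_sign_eq_of_tendsto {a b : ℕ} (hb : Odd b) {c : ℝ} {u : ℕ → ℝ} (hc : 0 < c)
    (hu : Tendsto (fun k : ℕ => u k - c * Real.cos ((k + 1) * (Real.pi * a / b))) atTop (nhds 0)) :
    ∀ᶠ k : ℕ in atTop,
      SignType.sign (u k) = SignType.sign (Real.cos ((k + 1) * (Real.pi * a / b))) := by
  obtain ⟨δ, hδ, h⟩ := exists_le_abs_cos (a := a) hb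
  have h1 := (Metric.tendsto_nhds.1 hu) (c * δ) (by positivity)
  filter_upwards [h1] with k hk
  have h2 := h k
  rw [Real.dist_eq, sub_zero, abs_lt] at hk
  set x := Real.cos ((k + 1) * (Real.pi * a / b))
  rcases abs_cases x with ⟨h3, h4⟩ | ⟨h3, h4⟩
  · have : c * δ ≤ c * x := by gcongr; linarith
    rw [sign_pos (by linarith), sign_pos (by linarith)]
  · have : c * δ ≤ c * (-x) := by gcongr; linarith
    rw [sign_neg (by linarith), sign_neg (by linarith)]

/-! ### High derivatives of a logarithm and the nearest zeros -/

/-- The local factorisation at `a` becomes global by dividing everywhere else; the removable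
singularity is filled with the value of the local cofactor. The exponent may be zero. -/
lemma Differentiable.exists_eq_pow_mul {f : ℂ → ℂ} (hf : Differentiable ℂ f) {w : ℂ} (hw : f w ≠ 0)
    (a : ℂ) : ∃ (m : ℕ) (g : ℂ → ℂ), Differentiable ℂ g ∧ g a ≠ 0 ∧
      ∀ z, f z = (z - a) ^ m * g z := by
  have han : AnalyticOnNhd ℂ f Set.univ := fun z _ => hf.analyticAt z
  have hne : ¬ ∀ᶠ z in nhds a, f z = 0 := fun h => hw <|
    han.eqOn_zero_of_preconnected_of_eventuallyEq_zero isPreconnected_univ (Set.mem_univ a) h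
      (Set.mem_univ w)
  obtain ⟨m, g, hg, hga, hfg⟩ :=
    ((hf.analyticAt a).exists_eventuallyEq_pow_smul_nonzero_iff).2 hne
  set G : ℂ → ℂ := Function.update (fun z => f z / (z - a) ^ m) a (g a) with hG
  have hGa : G a = g a := Function.update_self _ _ _
  have hGz : ∀ z, z ≠ a → G z = f z / (z - a) ^ m := fun z hz => Function.update_of_ne hz _ _
  refine ⟨m, G, fun z => ?_, hGa ▸ hga, fun z => ?_⟩
  · rcases eq_or_ne z a with rfl | hz
    · refine hg.differentiableAt.congr_of_eventuallyEq ?_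
      filter_upwards [hfg] with x hx
      rcases eq_or_ne x z with rfl | hxz
      · exact hGa
      · rw [hGz x hxz, hx, smul_eq_mul, mul_div_cancel_left₀]
        exact pow_ne_zero _ (sub_ne_zero.2 hxz)
    · have : DifferentiableAt ℂ (fun z => f z / (z - a) ^ m) z :=
        (hf z).div (by fun_prop) (pow_ne_zero _ (sub_ne_zero.2 hz))
      refine this.congr_of_eventuallyEq ?_
      filter_upwards [isOpen_ne.mem_nhds hz] with x hx using hGz x hx
  · rcases eq_or_ne z a with rfl | hz
    · rw [hGa, hfg.self_of_nhds, smul_eq_mul]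
    · rw [hGz z hz, mul_div_cancel₀]
      exact pow_ne_zero _ (sub_ne_zero.2 hz)

lemma iteratedDeriv_re_comp_ofReal {H : ℂ → ℂ} {s : ℝ} (hH : AnalyticAt ℂ H s) (k : ℕ) :
    iteratedDeriv k (fun x : ℝ => (H x).re) s = (iteratedDeriv k H s).re := by
  induction k generalizing H with
  | zero => simp
  | succ k ih =>
    rw [iteratedDeriv_succ', iteratedDeriv_succ', ← ih hH.deriv]
    refine Filter.EventuallyEq.iteratedDeriv_eq k ?_
    have : ∀ᶠ x : ℝ in nhds s, AnalyticAt ℂ H x :=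
      Complex.continuous_ofReal.continuousAt.eventually hH.eventually_analyticAt
    filter_upwards [this] with x hx
    exact (hx.differentiableAt.hasDerivAt.real_of_complex).deriv

lemma iteratedDeriv_sub_inv (k : ℕ) (a s : ℂ) :
    iteratedDeriv k (fun z => (z - a)⁻¹) s = (-1) ^ k * k.factorial * ((s - a)⁻¹) ^ (k + 1) := by
  have h := congrFun (iteratedDeriv_comp_sub_const k (fun z : ℂ => z⁻¹) a) s
  rw [h, iteratedDeriv_eq_iterate, iter_deriv_inv]
  congr 1
  rw [inv_pow, ← zpow_natCast, ← zpow_neg]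
  congr 1
  push_cast
  ring

lemma norm_pow_mul_re_inv_pow {w : ℂ} (hw : w ≠ 0) (k : ℕ) :
    ‖w‖ ^ k * ((w⁻¹) ^ k).re = Real.cos (k * w.arg) := by
  have hn : ‖w‖ ≠ 0 := norm_ne_zero_iff.2 hw
  have h1 : (w⁻¹) ^ k = (((‖w‖ ^ k)⁻¹ : ℝ) : ℂ) * Complex.exp ((-(k * w.arg) : ℝ) * Complex.I) := by
    conv_lhs => rw [← Complex.norm_mul_exp_arg_mul_I w]
    rw [mul_inv, mul_pow, ← Complex.exp_neg, ← Complex.exp_nat_mul]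
    push_cast
    rw [inv_pow]
    congr 2
    ring
  rw [h1, Complex.re_ofReal_mul, Complex.exp_ofReal_mul_I_re, Real.cos_neg]
  field_simp

lemma norm_pow_mul_re_inv_conj_pow {w : ℂ} (hw : w ≠ 0) (k : ℕ) :
    ‖w‖ ^ k * (((starRingEnd ℂ w)⁻¹) ^ k).re = Real.cos (k * w.arg) := by
  rw [← norm_pow_mul_re_inv_pow hw, ← map_inv₀, ← map_pow, Complex.conj_re]

/-- If the zeros of `f` nearest to `s` are `ρ` and its conjugate, then the high derivatives of
`log f` at `s` are dominated by their contribution. -/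
lemma exists_tendsto_iteratedDeriv_log {f : ℂ → ℂ} (hf : Differentiable ℂ f) {s : ℝ} {ρ : ℂ}
    (hpos : ∀ᶠ x : ℝ in nhds s, 0 < (f x).re ∧ (f x).im = 0) (hρ : f ρ = 0)
    (hnear : ∀ z, f z = 0 → ‖(s : ℂ) - z‖ ≤ ‖(s : ℂ) - ρ‖ → z = ρ ∨ z = starRingEnd ℂ ρ) :
    ∃ c > 0, Tendsto (fun k : ℕ => (-1) ^ k * ‖(s : ℂ) - ρ‖ ^ (k + 1) / k.factorial
      * iteratedDeriv (k + 1) (fun x : ℝ => Real.log (f x).re) s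
      - c * Real.cos ((k + 1) * ((s : ℂ) - ρ).arg)) atTop (nhds 0) := by
  have hfs : f s ≠ 0 := fun h => by
    have := hpos.self_of_nhds.1
    rw [h] at this
    simp at this
  set w : ℂ := (s : ℂ) - ρ with hw
  have hwc : (s : ℂ) - starRingEnd ℂ ρ = starRingEnd ℂ w := by simp [hw]
  have hw0 : w ≠ 0 := fun h => hfs (by rw [sub_eq_zero.1 h]; exact hρ)
  set r := ‖w‖ with hr
  have hr0 : 0 < r := norm_pos_iff.2 hw0
  obtain ⟨m, g₁, hg₁, hg₁a, hfg₁⟩ := hf.exists_eq_pow_mul hfs ρ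
  have hm : m ≠ 0 := by
    rintro rfl
    have := hfg₁ ρ
    rw [hρ, pow_zero, one_mul] at this
    exact hg₁a this.symm
  -- If `ρ` is real, all of the zero is already in `m` and `n = 0`. In general `m` and `n` need not
  -- be compared: a power and its conjugate have the same real part, so only `m + n` matters.
  obtain ⟨n, g, hg, hga, hfg⟩ := hg₁.exists_eq_pow_mul hg₁a (starRingEnd ℂ ρ)
  have hfac : ∀ z, f z = (z - ρ) ^ m * ((z - starRingEnd ℂ ρ) ^ n * g z) := fun z => by
    rw [hfg₁, hfg]
  have hgρ : g ρ ≠ 0 := fun h => hg₁a (by rw [hfg, h, mul_zero])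
  have hgball : Metric.closedBall (s : ℂ) r ⊆ {z | g z ≠ 0} := by
    intro z hz h
    rw [Metric.mem_closedBall, dist_comm, dist_eq_norm] at hz
    rcases hnear z (by rw [hfac, h, mul_zero, mul_zero]) hz with rfl | rfl
    · exact hgρ h
    · exact hga h
  -- The cofactor is zero-free on the closed disc of radius `r`, hence on one of radius `R > r`.
  -- Cauchy's estimate there leaves a relative error `O((r/R)^k)`.
  obtain ⟨δ, hδ, hδg⟩ := (isCompact_closedBall (s : ℂ) r).exists_cthickening_subset_open
    (isOpen_ne.preimage hg.continuous) hgball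
  rw [cthickening_closedBall hδ.le hr0.le] at hδg
  set R := δ + r with hR
  have hR0 : 0 < R := by positivity
  set h : ℂ → ℂ := fun z => deriv g z / g z with hh
  have hgd : Differentiable ℂ (deriv g) := fun z => (hg.analyticAt z).deriv.differentiableAt
  have hhd : DifferentiableOn ℂ h (Metric.closedBall (s : ℂ) R) := fun z hz =>
    ((hgd z).div (hg z) (hδg hz)).differentiableWithinAt
  have hhd' : DiffContOnCl ℂ h (Metric.ball (s : ℂ) R) :=
    hhd.diffContOnCl_ball subset_rfl
  obtain ⟨C, hC⟩ := (isCompact_closedBall (s : ℂ) R).exists_bound_of_continuousOn hhd.continuousOn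
  have hCau : ∀ k, ‖iteratedDeriv k h s‖ ≤ k.factorial * C / R ^ k := fun k =>
    Complex.norm_iteratedDeriv_le_of_forall_mem_sphere_norm_le k hR0 hhd'
      fun z hz => hC z (Metric.sphere_subset_closedBall hz)
  have hhan : AnalyticAt ℂ h s :=
    hhd.analyticAt (Metric.closedBall_mem_nhds _ hR0)
  have han1 : ∀ a : ℂ, (s : ℂ) - a ≠ 0 → AnalyticAt ℂ (fun z => (z - a)⁻¹) s := fun a ha =>
    (analyticAt_id.sub analyticAt_const).inv ha
  have hwc0 : (s : ℂ) - starRingEnd ℂ ρ ≠ 0 := by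
    rw [hwc]; exact (map_ne_zero _).2 hw0
  have hslit : f s ∈ Complex.slitPlane := Or.inl hpos.self_of_nhds.1
  have hlogan : AnalyticAt ℂ (fun z => Complex.log (f z)) s := (hf.analyticAt _).clog hslit
  have hder : deriv (fun z => Complex.log (f z)) =ᶠ[nhds (s : ℂ)]
      fun z => m * (z - ρ)⁻¹ + n * (z - starRingEnd ℂ ρ)⁻¹ + h z := by
    have e1 : ∀ᶠ z in nhds (s : ℂ), f z ∈ Complex.slitPlane :=
      hf.continuous.continuousAt.eventually (Complex.isOpen_slitPlane.mem_nhds hslit)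
    filter_upwards [e1] with z hz
    have hz0 := Complex.slitPlane_ne_zero hz
    rw [((hf z).hasDerivAt.clog hz).deriv]
    have hfz := hfac z
    have n1 : (z - ρ) ^ m ≠ 0 := fun h0 => hz0 (by rw [hfz, h0, zero_mul])
    have n2 : (z - starRingEnd ℂ ρ) ^ n ≠ 0 := fun h0 => hz0 (by rw [hfz, h0]; simp)
    have n3 : g z ≠ 0 := fun h0 => hz0 (by rw [hfz, h0]; simp)
    have d := congrFun (congrArg logDeriv (funext hfac)) z
    rw [logDeriv_mul (f := fun z => (z - ρ) ^ m)
      (g := fun z => (z - starRingEnd ℂ ρ) ^ n * g z) z n1 (mul_ne_zero n2 n3) (by fun_prop)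
      (((differentiable_id.sub_const _).pow n).mul hg z),
      logDeriv_mul (f := fun z => (z - starRingEnd ℂ ρ) ^ n) (g := g) z n2 n3 (by fun_prop) (hg z),
      logDeriv_fun_pow (by fun_prop), logDeriv_fun_pow (by fun_prop)] at d
    simp only [logDeriv_apply, deriv_sub_const, deriv_id''] at d
    rw [d, hh]
    ring
  have hF : (fun x : ℝ => Real.log (f x).re) =ᶠ[nhds s] fun x : ℝ => (Complex.log (f x)).re := by
    filter_upwards [hpos] with x hx
    rw [Complex.log_re]
    congr 1
    rw [Complex.norm_def, Complex.normSq_apply, hx.2, mul_zero, add_zero, Real.sqrt_mul_self hx.1.le]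
  have hit : ∀ k, iteratedDeriv (k + 1) (fun x : ℝ => Real.log (f x).re) s
      = m * ((-1) ^ k * k.factorial * ((w⁻¹) ^ (k + 1)).re)
        + n * ((-1) ^ k * k.factorial * (((starRingEnd ℂ w)⁻¹) ^ (k + 1)).re)
        + (iteratedDeriv k h s).re := by
    intro k
    rw [hF.iteratedDeriv_eq, iteratedDeriv_re_comp_ofReal hlogan, iteratedDeriv_succ',
      hder.iteratedDeriv_eq]
    have c1 : ContDiffAt ℂ k (fun z : ℂ => (m : ℂ) * (z - ρ)⁻¹) s :=
      (analyticAt_const.mul (han1 ρ hw0)).contDiffAt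
    have c2 : ContDiffAt ℂ k (fun z : ℂ => (n : ℂ) * (z - starRingEnd ℂ ρ)⁻¹) s :=
      (analyticAt_const.mul (han1 _ hwc0)).contDiffAt
    rw [iteratedDeriv_fun_add (c1.add c2) hhan.contDiffAt, iteratedDeriv_fun_add c1 c2,
      iteratedDeriv_const_mul_field, iteratedDeriv_const_mul_field, iteratedDeriv_sub_inv,
      iteratedDeriv_sub_inv, hwc, ← hw, Complex.add_re, Complex.add_re]
    have hre : ∀ (j : ℕ) (v : ℂ), ((j : ℂ) * ((-1) ^ k * k.factorial * v)).re
        = j * ((-1) ^ k * k.factorial * v.re) := by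
      intro j v
      rw [show ((j : ℂ) * ((-1) ^ k * k.factorial * v))
        = ((j * ((-1) ^ k * k.factorial) : ℝ) : ℂ) * v by push_cast; ring, Complex.re_ofReal_mul]
      ring
    rw [hre, hre]
  refine ⟨m + n, by positivity, ?_⟩
  have hlim : Tendsto (fun k : ℕ => r * C * (r / R) ^ k) atTop (nhds 0) := by
    have : r / R < 1 := (div_lt_one hR0).2 (by linarith)
    simpa using (tendsto_pow_atTop_nhds_zero_of_lt_one (by positivity) this).const_mul (r * C)
  refine squeeze_zero_norm (fun k => ?_) hlim
  have hsq : ((-1 : ℝ) ^ k) * (-1) ^ k = 1 := by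
    rw [← mul_pow]; norm_num
  have hfac0 : (k.factorial : ℝ) ≠ 0 := by positivity
  have h1 := norm_pow_mul_re_inv_pow hw0 (k + 1)
  have h2 := norm_pow_mul_re_inv_conj_pow hw0 (k + 1)
  push_cast at h1 h2
  have heq : (-1) ^ k * r ^ (k + 1) / k.factorial
      * iteratedDeriv (k + 1) (fun x : ℝ => Real.log (f x).re) s
      - (m + n) * Real.cos ((k + 1) * w.arg)
      = (-1) ^ k * r ^ (k + 1) / k.factorial * (iteratedDeriv k h s).re := by
    rw [hit]
    have : ∀ x y v : ℝ, (-1) ^ k * r ^ (k + 1) / k.factorial *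
        (m * ((-1) ^ k * k.factorial * x) + n * ((-1) ^ k * k.factorial * y) + v)
        = ((-1) ^ k * (-1) ^ k) * (m * (r ^ (k + 1) * x) + n * (r ^ (k + 1) * y))
          + (-1) ^ k * r ^ (k + 1) / k.factorial * v := by
      intro x y v
      field_simp
    rw [this, hsq, h1, h2]
    ring
  rw [heq, Real.norm_eq_abs, abs_mul, abs_div, abs_mul, abs_pow, abs_neg, abs_one, one_pow, one_mul,
    abs_of_pos (by positivity : 0 < r ^ (k + 1)), abs_of_pos (by positivity : (0 : ℝ) < k.factorial)]
  calc r ^ (k + 1) / k.factorial * |(iteratedDeriv k h s).re|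
      ≤ r ^ (k + 1) / k.factorial * (k.factorial * C / R ^ k) := by
        gcongr
        exact (Complex.abs_re_le_norm _).trans (hCau k)
    _ = r * C * (r / R) ^ k := by
        rw [div_pow]; field_simp; ring

/-! ### Real characters: conjugation, positivity, functional equation, location of zeros -/

namespace DirichletCharacter

variable {q : ℕ} {χ : DirichletCharacter ℂ q}

lemma gammaFactor_ne_zero {s : ℂ} (hs : 0 < s.re) : gammaFactor χ s ≠ 0 := by
  rcases χ.even_or_odd with h | h
  · rw [h.gammaFactor_def]; exact Complex.Gammaℝ_ne_zero_of_re_pos hs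
  · rw [h.gammaFactor_def]
    exact Complex.Gammaℝ_ne_zero_of_re_pos (by rw [Complex.add_re, Complex.one_re]; linarith)

/-- `Complex.Gamma` takes the value `0` at its poles, so the zeros of the Gamma factor are in fact
its poles, the source of the trivial zeros. -/
lemma im_eq_zero_of_gammaFactor_eq_zero {s : ℂ} (hs : gammaFactor χ s = 0) : s.im = 0 := by
  rcases χ.even_or_odd with h | h
  · rw [h.gammaFactor_def] at hs
    obtain ⟨n, rfl⟩ := Complex.Gammaℝ_eq_zero_iff.1 hs
    simp
  · rw [h.gammaFactor_def] at hs
    obtain ⟨n, hn⟩ := Complex.Gammaℝ_eq_zero_iff.1 hs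
    have := congrArg Complex.im hn
    simpa using this

lemma inv_eq_self_of_im_eq_zero (hr : ∀ a, (χ a).im = 0) : χ⁻¹ = χ := by
  rw [← MulChar.star_eq_inv]
  ext a
  rw [MulChar.star_apply]
  exact Complex.conj_eq_iff_im.2 (hr _)

variable [NeZero q]

lemma modulus_ne_one (hχ : χ ≠ 1) : q ≠ 1 := by
  rintro rfl
  exact hχ (level_one χ)

/-- The Dirichlet series has real coefficients; the identity theorem extends the symmetry from `Re s
> 1`. -/
lemma LFunction_conj (hχ : χ ≠ 1) (hr : ∀ a, (χ a).im = 0) (s : ℂ) :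
    LFunction χ (starRingEnd ℂ s) = starRingEnd ℂ (LFunction χ s) := by
  have hd := differentiable_LFunction hχ
  have hd' : Differentiable ℂ (starRingEnd ℂ ∘ LFunction χ ∘ starRingEnd ℂ) := fun z =>
    differentiableAt_conj_conj_iff.2 (hd _)
  have han : AnalyticOnNhd ℂ (LFunction χ) Set.univ := fun z _ => hd.analyticAt z
  have han' : AnalyticOnNhd ℂ (starRingEnd ℂ ∘ LFunction χ ∘ starRingEnd ℂ) Set.univ :=
    fun z _ => hd'.analyticAt z
  have hopen : {z : ℂ | 1 < z.re} ∈ nhds (2 : ℂ) :=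
    (isOpen_lt continuous_const Complex.continuous_re).mem_nhds (by simp)
  have heq : LFunction χ =ᶠ[nhds (2 : ℂ)] starRingEnd ℂ ∘ LFunction χ ∘ starRingEnd ℂ := by
    filter_upwards [hopen] with z hz
    have hz' : 1 < (starRingEnd ℂ z).re := by simpa using hz
    simp only [Function.comp_apply]
    rw [LFunction_eq_LSeries χ hz, LFunction_eq_LSeries χ hz', LSeries, LSeries, Complex.conj_tsum]
    refine tsum_congr fun n => ?_
    rcases eq_or_ne n 0 with rfl | hn
    · simp
    · rw [LSeries.term_of_ne_zero hn, LSeries.term_of_ne_zero hn, map_div₀,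
        Complex.conj_eq_iff_im.2 (hr _)]
      congr 1
      have harg : ((n : ℂ)).arg ≠ Real.pi := by
        rw [Complex.natCast_arg]; exact Real.pi_pos.ne
      have h := Complex.cpow_conj (n : ℂ) z harg
      rw [Complex.conj_natCast] at h
      rw [h, Complex.conj_conj]
  have h := congrFun (han.eq_of_eventuallyEq han' heq) (starRingEnd ℂ s)
  simpa using h

/-- The Euler product is the exponential of a sum over primes, and for a real character at a real
point each term is real. -/
lemma LFunction_ofReal_pos (hr : ∀ a, (χ a).im = 0) {x : ℝ} (hx : 1 < x) :
    0 < (LFunction χ x).re ∧ (LFunction χ x).im = 0 := by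
  have hx' : 1 < (x : ℂ).re := by simpa using hx
  have hterm : ∀ p : Nat.Primes, -Complex.log (1 - χ p * (p : ℂ) ^ (-(x : ℂ)))
      = ((-Real.log (1 - (χ p).re * (p : ℝ) ^ (-x)) : ℝ) : ℂ) := by
    intro p
    have h1 : (χ p : ℂ) = ((χ p).re : ℂ) := by
      apply Complex.ext <;> simp [hr]
    have hp1 : (1 : ℝ) ≤ p := by exact_mod_cast p.2.one_lt.le
    have h2 : (p : ℝ) ^ (-x) ≤ 1 := Real.rpow_le_one_of_one_le_of_nonpos hp1 (by linarith)
    have h3 : |(χ p).re| ≤ 1 := (Complex.abs_re_le_norm _).trans (norm_le_one _ _)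
    have h4 : 0 ≤ (p : ℝ) ^ (-x) := by positivity
    have h5 : 0 ≤ 1 - (χ p).re * (p : ℝ) ^ (-x) := by
      nlinarith [abs_le.1 h3]
    rw [Complex.ofReal_neg, Complex.ofReal_log h5]
    push_cast
    rw [← h1, Complex.ofReal_cpow (by positivity)]
    push_cast
    rfl
  rw [LFunction_eq_LSeries χ hx', ← LSeries_eulerProduct_exp_log χ hx']
  simp_rw [hterm]
  rw [← Complex.ofReal_tsum, ← Complex.ofReal_exp]
  exact ⟨Real.exp_pos _, Complex.ofReal_im _⟩

lemma completedLFunction_eq_mul (hχ : χ ≠ 1) {s : ℂ} (hs : 0 < s.re) :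
    completedLFunction χ s = gammaFactor χ s * LFunction χ s := by
  rw [LFunction_eq_completed_div_gammaFactor χ s (Or.inr (modulus_ne_one hχ)),
    mul_div_cancel₀ _ (gammaFactor_ne_zero hs)]

lemma completedLFunction_one_sub_of_real (hp : χ.IsPrimitive) (hr : ∀ a, (χ a).im = 0) (s : ℂ) :
    completedLFunction χ (1 - s) = q ^ (s - 1 / 2) * rootNumber χ * completedLFunction χ s := by
  have h := hp.completedLFunction_one_sub s
  rwa [inv_eq_self_of_im_eq_zero hr] at h

/-- Neither the Gamma factor nor `L` vanishes for `Re s ≥ 1`; the functional equation reflects this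
to `Re s ≤ 0`. -/
lemma isNontrivialZero_of_completedLFunction_eq_zero (hp : χ.IsPrimitive) (hχ : χ ≠ 1)
    (hr : ∀ a, (χ a).im = 0) {s : ℂ} (hs : completedLFunction χ s = 0) :
    IsNontrivialZero χ s := by
  have key : ∀ z, completedLFunction χ z = 0 → z.re < 1 := by
    intro z hz
    by_contra! h
    rw [completedLFunction_eq_mul hχ (by linarith)] at hz
    exact mul_ne_zero (gammaFactor_ne_zero (by linarith))
      (LFunction_ne_zero_of_one_le_re χ (Or.inl hχ) h) hz
  have h1 := key s hs
  have h2 := key (1 - s) (by rw [completedLFunction_one_sub_of_real hp hr, hs, mul_zero])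
  rw [Complex.sub_re, Complex.one_re] at h2
  refine ⟨?_, by linarith, h1⟩
  rw [LFunction_eq_completed_div_gammaFactor χ s (Or.inr (modulus_ne_one hχ)), hs, zero_div]

lemma isNontrivialZero_one_sub (hp : χ.IsPrimitive) (hχ : χ ≠ 1)
    (hr : ∀ a, (χ a).im = 0) {s : ℂ} (hs : IsNontrivialZero χ s) :
    IsNontrivialZero χ (1 - s) := by
  refine isNontrivialZero_of_completedLFunction_eq_zero hp hχ hr ?_
  rw [completedLFunction_one_sub_of_real hp hr, completedLFunction_eq_mul hχ hs.2.1, hs.1, mul_zero,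
    mul_zero]

lemma isNontrivialZero_conj (hχ : χ ≠ 1)
    (hr : ∀ a, (χ a).im = 0) {s : ℂ} (hs : IsNontrivialZero χ s) :
    IsNontrivialZero χ (starRingEnd ℂ s) := by
  refine ⟨?_, by simpa using hs.2.1, by simpa using hs.2.2⟩
  rw [LFunction_conj hχ hr, hs.1, map_zero]

lemma isNontrivialZero_or_of_LFunction_eq_zero (hp : χ.IsPrimitive) (hχ : χ ≠ 1)
    (hr : ∀ a, (χ a).im = 0) {s : ℂ} (hs : LFunction χ s = 0) :
    IsNontrivialZero χ s ∨ (s.im = 0 ∧ s.re ≤ 0) := by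
  have h1 : s.re < 1 := by
    by_contra! h
    exact LFunction_ne_zero_of_one_le_re χ (Or.inl hχ) h hs
  rcases lt_or_ge 0 s.re with h0 | h0
  · exact Or.inl ⟨hs, h0, h1⟩
  rw [LFunction_eq_completed_div_gammaFactor χ s (Or.inr (modulus_ne_one hχ)), div_eq_zero_iff] at hs
  rcases hs with hs | hs
  · exact Or.inl (isNontrivialZero_of_completedLFunction_eq_zero hp hχ hr hs)
  · exact Or.inr ⟨im_eq_zero_of_gammaFactor_eq_zero hs, h0⟩

/-! ### Size of the L-function in the right half-plane -/

lemma sum_range_modulus (hχ : χ ≠ 1) : ∑ k ∈ Finset.range q, χ (k : ZMod q) = 0 := by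
  rw [← MulChar.sum_eq_zero_of_ne_one hχ]
  refine Finset.sum_nbij' (fun k => (k : ZMod q)) ZMod.val (fun _ _ => Finset.mem_univ _)
    (fun a _ => Finset.mem_range.2 (ZMod.val_lt a)) (fun k hk => ?_) (fun a _ => ?_) (fun _ _ => rfl)
  · exact ZMod.val_cast_of_lt (Finset.mem_range.1 hk)
  · exact ZMod.natCast_zmod_val a

/-- Sums over full periods cancel, so only fewer than one or exactly one period of terms of norm at
most `1` is left. -/
lemma norm_sum_range_le (hχ : χ ≠ 1) (n : ℕ) :
    ‖∑ k ∈ Finset.range n, χ (k : ZMod q)‖ ≤ q := by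
  induction n using Nat.strong_induction_on with
  | _ n ih =>
    rcases le_or_gt n q with h | h
    · refine (norm_sum_le_of_le _ fun k _ => norm_le_one χ _).trans ?_
      simpa using h
    · obtain ⟨m, rfl⟩ := Nat.exists_eq_add_of_lt h
      rw [add_assoc, Finset.sum_range_add, sum_range_modulus hχ, zero_add]
      simp only [Nat.cast_add q, ZMod.natCast_self, zero_add]
      exact ih _ (by have := NeZero.pos q; omega)

lemma norm_sum_Icc_le (hχ : χ ≠ 1) (n : ℕ) :
    ‖∑ k ∈ Finset.Icc 1 n, χ (k : ZMod q)‖ ≤ q := by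
  have h0 : χ (0 : ZMod q) = 0 := χ.map_zero' (modulus_ne_one hχ)
  have h : ∑ k ∈ Finset.Icc 1 n, χ (k : ZMod q) = ∑ k ∈ Finset.range (n + 1), χ (k : ZMod q) := by
    rw [Finset.range_eq_Ico, Finset.sum_eq_sum_Ico_succ_bot (Nat.succ_pos n), Nat.cast_zero, h0,
      zero_add]
    rfl
  rw [h]
  exact norm_sum_range_le hχ _

lemma norm_integral_partialSum_le (hχ : χ ≠ 1) {s : ℂ} (hs : 0 < s.re) :
    ‖∫ t in Set.Ioi (1 : ℝ), (∑ k ∈ Finset.Icc 1 ⌊t⌋₊, χ (k : ZMod q)) * (t : ℂ) ^ (-(s + 1))‖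
      ≤ q / s.re := by
  have h1 : (∫ t in Set.Ioi (1 : ℝ), (q : ℝ) * t ^ (-s.re - 1)) = q / s.re := by
    rw [MeasureTheory.integral_const_mul, integral_Ioi_rpow_of_lt (by linarith) one_pos,
      Real.one_rpow]
    rw [sub_add_cancel, neg_div_neg_eq, mul_one_div]
  rw [← h1]
  refine MeasureTheory.norm_integral_le_of_norm_le
    ((integrableOn_Ioi_rpow_of_lt (by linarith) one_pos).const_mul _) ?_
  refine (MeasureTheory.ae_restrict_iff' measurableSet_Ioi).2 (Eventually.of_forall fun t ht => ?_)
  have ht0 : 0 < t := lt_trans one_pos ht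
  rw [norm_mul, Complex.norm_cpow_eq_rpow_re_of_pos ht0]
  have : (-(s + 1)).re = -s.re - 1 := by simp; ring
  rw [this]
  gcongr
  exact norm_sum_Icc_le hχ _

/-- Abel summation gives this for `Re s > 1`. The right side is the Mellin transform of a bounded
function supported on `t > 1`, hence analytic for `Re s > 0`, and the identity theorem applies. -/
lemma LFunction_eq_mul_integral (hχ : χ ≠ 1) {s : ℂ} (hs : 0 < s.re) :
    LFunction χ s = s * ∫ t in Set.Ioi (1 : ℝ),
      (∑ k ∈ Finset.Icc 1 ⌊t⌋₊, χ (k : ZMod q)) * (t : ℂ) ^ (-(s + 1)) := by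
  set S : ℝ → ℂ := fun t => ∑ k ∈ Finset.Icc 1 ⌊t⌋₊, χ (k : ZMod q) with hS
  set f : ℝ → ℂ := (Set.Ioi (1 : ℝ)).indicator S with hf
  have hfb : ∀ t, ‖f t‖ ≤ q := fun t =>
    (norm_indicator_le_norm_self S t).trans (norm_sum_Icc_le hχ _)
  have hSm : Measurable S :=
    (Measurable.of_discrete (f := fun n : ℕ => ∑ k ∈ Finset.Icc 1 n, χ (k : ZMod q))).comp
      Nat.measurable_floor
  have hfm : Measurable f := hSm.indicator measurableSet_Ioi
  have hmel : ∀ z : ℂ, mellin f (-z) = ∫ t in Set.Ioi (1 : ℝ), S t * (t : ℂ) ^ (-(z + 1)) := by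
    intro z
    have h1 : ∀ t : ℝ, (t : ℂ) ^ (-z - 1) • f t
        = (Set.Ioi (1 : ℝ)).indicator (fun t : ℝ => S t * (t : ℂ) ^ (-(z + 1))) t := by
      intro t
      rw [hf, Set.indicator_apply, Set.indicator_apply]
      split_ifs
      · rw [smul_eq_mul, mul_comm, neg_add, sub_eq_add_neg]
      · rw [smul_zero]
    rw [mellin]
    simp_rw [h1]
    rw [MeasureTheory.setIntegral_indicator measurableSet_Ioi,
      Set.inter_eq_right.2 (Set.Ioi_subset_Ioi zero_le_one)]
  have hloc : MeasureTheory.LocallyIntegrableOn f (Set.Ioi 0) := by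
    refine MeasureTheory.LocallyIntegrable.locallyIntegrableOn ?_ _
    exact (MeasureTheory.locallyIntegrable_const (q : ℝ)).mono hfm.aestronglyMeasurable
      (Eventually.of_forall fun t => by simpa using hfb t)
  have hdiff : ∀ z : ℂ, 0 < z.re → DifferentiableAt ℂ (fun z => z * mellin f (-z)) z := by
    intro z hz
    have h : DifferentiableAt ℂ (mellin f) (-z) := by
      -- Boundedness at infinity gives the exponent `0`. Near `0` the function vanishes, so any
      -- exponent below `-Re z` is allowed.
      refine mellin_differentiableAt_of_isBigO_rpow (a := 0) (b := -z.re - 1) hloc ?_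
        (by simpa using hz) ?_ (by simp)
      · refine Asymptotics.IsBigO.of_bound q (Eventually.of_forall fun t => ?_)
        simpa using hfb t
      · refine Asymptotics.IsBigO.of_bound 0 ?_
        filter_upwards [mem_nhdsWithin_of_mem_nhds (Iio_mem_nhds one_pos)] with t ht
        rw [hf, Set.indicator_of_notMem (by simpa using (Set.mem_Iio.1 ht).le)]
        simp
    exact differentiableAt_id.mul (h.comp z (differentiable_neg z))
  have hU : IsOpen {z : ℂ | 0 < z.re} := isOpen_lt continuous_const Complex.continuous_re
  have hconv : Convex ℝ {z : ℂ | 0 < z.re} := convex_halfSpace_re_gt 0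
  have ha : AnalyticOnNhd ℂ (LFunction χ) {z : ℂ | 0 < z.re} :=
    fun z _ => (differentiable_LFunction hχ).analyticAt z
  have hb : AnalyticOnNhd ℂ (fun z => z * mellin f (-z)) {z : ℂ | 0 < z.re} :=
    DifferentiableOn.analyticOnNhd (fun z hz => (hdiff z hz).differentiableWithinAt) hU
  have h2 : (2 : ℂ) ∈ {z : ℂ | 0 < z.re} := by simp
  have hopen : {z : ℂ | 1 < z.re} ∈ nhds (2 : ℂ) :=
    (isOpen_lt continuous_const Complex.continuous_re).mem_nhds (by simp)
  have heq : LFunction χ =ᶠ[nhds (2 : ℂ)] fun z => z * mellin f (-z) := by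
    filter_upwards [hopen] with z hz
    rw [hmel, LFunction_eq_LSeries χ hz]
    refine LSeries_eq_mul_integral (fun n : ℕ => χ (n : ZMod q)) le_rfl (lt_trans one_pos hz)
      (LSeriesSummable_of_one_lt_re χ hz) ?_
    refine Asymptotics.IsBigO.of_bound q (Eventually.of_forall fun n => ?_)
    simpa using norm_sum_Icc_le hχ n
  have h := ha.eqOn_of_preconnected_of_eventuallyEq hb hconv.isPreconnected h2 heq hs
  rw [h, ← hmel]

lemma norm_LFunction_le (hχ : χ ≠ 1) {s : ℂ} (hs : 0 < s.re) :
    ‖LFunction χ s‖ ≤ q * ‖s‖ / s.re := by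
  rw [LFunction_eq_mul_integral hχ hs, norm_mul, mul_comm (q : ℝ), mul_div_assoc]
  gcongr
  exact norm_integral_partialSum_le hχ hs

/-- The difference is at most `ζ(2) - 1 = π²/6 - 1 < 2/3`. -/
lemma norm_LFunction_sub_one_le {s : ℂ} (hs : 2 ≤ s.re) :
    ‖LFunction χ s - 1‖ ≤ 2 / 3 := by
  have hs1 : 1 < s.re := by linarith
  have hsum := LSeriesSummable_of_one_lt_re χ hs1
  rw [LFunction_eq_LSeries χ hs1, LSeries, ← Summable.sum_add_tsum_nat_add 2 hsum]
  have h01 : ∑ i ∈ Finset.range 2, LSeries.term (fun n => χ (n : ZMod q)) s i = 1 := by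
    simp [Finset.sum_range_succ, LSeries.term_def]
  rw [h01, add_sub_cancel_left]
  have hz := hasSum_zeta_two
  have hz2 : HasSum (fun n : ℕ => 1 / ((n + 2 : ℕ) : ℝ) ^ 2) (Real.pi ^ 2 / 6 - 1) := by
    have := (hasSum_nat_add_iff' 2).2 hz
    simpa [Finset.sum_range_succ] using this
  refine (tsum_of_norm_bounded hz2 fun n => ?_).trans ?_
  · rw [LSeries.term_of_ne_zero (by omega), norm_div, Complex.norm_natCast_cpow_of_pos (by omega)]
    have h1 : (1 : ℝ) ≤ ((n + 2 : ℕ) : ℝ) := by exact_mod_cast (by omega : 1 ≤ n + 2)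
    gcongr
    · exact norm_le_one _ _
    · rw [← Real.rpow_natCast]
      exact Real.rpow_le_rpow_of_exponent_le h1 (by exact_mod_cast hs)
  · have := Real.pi_lt_d2
    have := Real.pi_pos
    nlinarith

end DirichletCharacter

/-! ### An effective bound for the lowest zero -/

/-- A zero-free even function on a large disc, of moderate size, is nearly constant near `0`. -/
lemma Complex.abs_log_norm_sub_le_of_even {X : ℂ → ℂ} (hX : Differentiable ℂ X)
    (heven : ∀ w, X (-w) = X w) {R r A : ℝ} (hr : 0 < r) (hrR : 8 * r < R)
    (hne : ∀ w ∈ Metric.ball (0 : ℂ) R, X w ≠ 0) {x y : ℂ} (hx : ‖x‖ ≤ r) (hy : ‖y‖ ≤ r)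
    (hA : 0 < A) (hM : ∀ w ∈ Metric.ball (0 : ℂ) R, Real.log ‖X w‖ - Real.log ‖X x‖ ≤ A) :
    |Real.log ‖X y‖ - Real.log ‖X x‖| ≤ 128 * A * (r / R) ^ 2 := by
  have hR : 0 < R := by linarith
  have hdX : Differentiable ℂ (deriv X) := fun z => (hX.analyticAt z).deriv.differentiableAt
  have hld : DifferentiableOn ℂ (fun w => deriv X w / X w) (Metric.ball 0 R) := fun w hw =>
    ((hdX w).div (hX w) (hne w hw)).differentiableWithinAt
  have h0mem : (0 : ℂ) ∈ Metric.ball (0 : ℂ) R := Metric.mem_ball_self hR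
  obtain ⟨h, hh0, hh⟩ := hld.isExactOn_ball.with_val_at 0 (Complex.log (X 0))
  have hdiff : DifferentiableOn ℂ h (Metric.ball 0 R) := fun w hw =>
    (hh w hw).differentiableAt.differentiableWithinAt
  have hexp : ∀ w ∈ Metric.ball (0 : ℂ) R, X w = Complex.exp (h w) := by
    have hd : ∀ w ∈ Metric.ball (0 : ℂ) R, HasDerivAt (fun w => X w * Complex.exp (-h w)) 0 w := by
      intro w hw
      have h1 : HasDerivAt (fun w => X w * Complex.exp (-h w)) (deriv X w * Complex.exp (-h w)
          + X w * (Complex.exp (-h w) * -(deriv X w / X w))) w :=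
        (hX w).hasDerivAt.mul (hh w hw).neg.cexp
      have h2 := hne w hw
      rwa [show deriv X w * Complex.exp (-h w)
        + X w * (Complex.exp (-h w) * -(deriv X w / X w)) = 0 by field_simp; ring] at h1
    intro w hw
    have hc := (convex_ball (0 : ℂ) R).is_const_of_fderivWithin_eq_zero (𝕜 := ℂ)
      (f := fun w => X w * Complex.exp (-h w))
      (fun w hw => (hd w hw).differentiableAt.differentiableWithinAt)
      (fun w hw => by
        rw [fderivWithin_of_isOpen Metric.isOpen_ball hw, (hd w hw).hasFDerivAt.fderiv]
        ext; simp) hw h0mem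
    rw [hh0, Complex.exp_neg (Complex.log _), Complex.exp_log (hne 0 h0mem),
      mul_inv_cancel₀ (hne 0 h0mem), Complex.exp_neg, mul_inv_eq_one₀ (Complex.exp_ne_zero _)] at hc
    exact hc
  have hlog : ∀ w ∈ Metric.ball (0 : ℂ) R, Real.log ‖X w‖ = (h w).re := fun w hw => by
    rw [hexp w hw, Complex.norm_exp, Real.log_exp]
  have hmem : ∀ w : ℂ, ‖w‖ ≤ r → w ∈ Metric.ball (0 : ℂ) R := fun w hw => by
    rw [mem_ball_zero_iff]; linarith
  have hxm := hmem x hx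
  have hym := hmem y hy
  -- Borel–Carathéodory is centred at `x`, where the lower bound for `X` is available. Since `R >
  -- 8r`, the disc `|z| < R/4` lies within half of the radius `R - r` around `x`.
  have hBC : ∀ z ∈ Metric.ball (0 : ℂ) (R / 4), ‖h z - h x‖ ≤ 2 * A := by
    intro z hz
    rw [mem_ball_zero_iff] at hz
    have hRr : 0 < R - r := by linarith
    have hsub : ∀ w ∈ Metric.ball (0 : ℂ) (R - r), x + w ∈ Metric.ball (0 : ℂ) R := by
      intro w hw
      rw [mem_ball_zero_iff] at hw ⊢
      linarith [norm_add_le x w]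
    have hzx : ‖z - x‖ ≤ (R - r) / 2 := by linarith [norm_sub_le z x]
    have hb := Complex.borelCaratheodory_zero (f := fun w => h (x + w) - h x) (R := R - r) hA
      (z := z - x)
      (fun w hw => (((hh _ (hsub w hw)).differentiableAt.comp w
        (differentiableAt_id.const_add x)).sub_const _).differentiableWithinAt)
      (fun w hw => by
        have := hM _ (hsub w hw)
        rw [hlog _ (hsub w hw), hlog x hxm] at this
        simpa using this) hRr (by rw [mem_ball_zero_iff]; linarith) (by simp)
    simp only [add_sub_cancel] at hb
    refine hb.trans ?_
    rw [div_le_iff₀ (by linarith)]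
    nlinarith [norm_nonneg (z - x)]
  -- Evenness kills the linear term at `0`; the Schwarz lemma then gains the square of `r/R` instead
  -- of the first power.
  have hder0 : HasDerivAt h 0 0 := by
    have hd0 : deriv X 0 = 0 := by
      have h1 : deriv (fun w => X (-w)) 0 = -deriv X (-0) := deriv_comp_neg X 0
      rw [funext heven, neg_zero] at h1
      exact self_eq_neg.1 h1
    have := hh 0 h0mem
    rwa [hd0, zero_div] at this
  have hlittle : (fun z => h z - h 0) =o[nhds (0 : ℂ)] fun z => (z - 0) ^ 1 := by
    have := hder0.isLittleO
    simpa using this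
  have hR4 : 0 < R / 4 := by linarith
  have h0m : (0 : ℂ) ∈ Metric.ball (0 : ℂ) (R / 4) := Metric.mem_ball_self hR4
  have hSch : ∀ z : ℂ, ‖z‖ ≤ r → ‖h z - h 0‖ ≤ 64 * A * (r / R) ^ 2 := by
    intro z hz
    have hs := Complex.dist_le_mul_div_pow_of_mapsTo_ball_of_isLittleO (f := h) (c := 0) (z := z)
      (R₁ := R / 4) (R₂ := 4 * A) (n := 1)
      (hdiff.mono (Metric.ball_subset_ball (by linarith)))
      (fun w hw => by
        rw [Metric.mem_closedBall, dist_eq_norm]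
        have h1 := hBC w hw
        have h2 := hBC 0 h0m
        calc ‖h w - h 0‖ = ‖(h w - h x) - (h 0 - h x)‖ := by congr 1; ring
          _ ≤ _ := (norm_sub_le _ _).trans (by linarith))
      (by simpa using hlittle.norm_right) (by rw [mem_ball_zero_iff]; linarith)
    rw [dist_eq_norm, dist_zero_right] at hs
    refine hs.trans ?_
    calc 4 * A * (‖z‖ / (R / 4)) ^ (1 + 1) ≤ 4 * A * (r / (R / 4)) ^ (1 + 1) := by gcongr
      _ = 64 * A * (r / R) ^ 2 := by
        rw [show r / (R / 4) = 4 * (r / R) by field_simp]; ring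
  rw [hlog y hym, hlog x hxm, ← Complex.sub_re]
  refine (Complex.abs_re_le_norm _).trans ?_
  calc ‖h y - h x‖ = ‖(h y - h 0) - (h x - h 0)‖ := by congr 1; ring
    _ ≤ _ := (norm_sub_le _ _).trans (by linarith [hSch x hx, hSch y hy])

lemma Complex.norm_Gamma_le {s : ℂ} (hs : 0 < s.re) : ‖Complex.Gamma s‖ ≤ Real.Gamma s.re := by
  rw [Complex.Gamma_eq_integral hs, Real.Gamma_eq_integral hs, Complex.GammaIntegral]
  refine (MeasureTheory.norm_integral_le_integral_norm _).trans (le_of_eq ?_)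
  refine MeasureTheory.setIntegral_congr_fun measurableSet_Ioi fun x hx => ?_
  rw [norm_mul, Complex.norm_cpow_eq_rpow_re_of_pos hx, Complex.norm_real, Real.norm_eq_abs,
    abs_of_pos (Real.exp_pos _)]
  simp

/-- Two steps of `Γ(u + 1) = u Γ(u)` lead into `[2, ∞)`, where `Γ` increases and is at most `n! ≤ n
^ n`. The factor `4` pays for dividing by `u(u + 1) ≥ 1/4`. -/
lemma Real.Gamma_le_of_le_natCast {u : ℝ} {n : ℕ} (hu : 1 / 4 ≤ u) (hn : u + 1 ≤ n) :
    Real.Gamma u ≤ 4 * (n : ℝ) ^ n := by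
  have h1 : Real.Gamma (u + 1 + 1) = (u + 1) * (u * Real.Gamma u) := by
    rw [Real.Gamma_add_one (by positivity), Real.Gamma_add_one (by positivity)]
  have h2 : Real.Gamma (u + 1 + 1) ≤ Real.Gamma (n + 1) :=
    Real.Gamma_strictMonoOn_Ici.monotoneOn (by simp; linarith) (by simp; linarith) (by linarith)
  rw [Real.Gamma_nat_eq_factorial, h1] at h2
  have h3 : (n.factorial : ℝ) ≤ (n : ℝ) ^ n := by exact_mod_cast n.factorial_le_pow
  have h4 : 0 < Real.Gamma u := Real.Gamma_pos_of_pos (by linarith)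
  nlinarith [mul_nonneg (sub_nonneg.2 hu) h4.le, mul_nonneg (mul_nonneg (sub_nonneg.2 hu) h4.le)
    (by linarith : (0:ℝ) ≤ u)]

lemma Complex.norm_Gammaℝ_le {s : ℂ} {n : ℕ} (hs : 1 / 2 ≤ s.re) (hn : s.re / 2 + 1 ≤ n) :
    ‖Complex.Gammaℝ s‖ ≤ 4 * (n : ℝ) ^ n := by
  have hre : (s / 2).re = s.re / 2 := by simp
  rw [Complex.Gammaℝ_def, norm_mul, Complex.norm_cpow_eq_rpow_re_of_pos Real.pi_pos]
  have h1 : Real.pi ^ (-s / 2).re ≤ 1 :=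
    Real.rpow_le_one_of_one_le_of_nonpos (by linarith [Real.pi_gt_three]) (by simp; linarith)
  have h2 := Complex.norm_Gamma_le (s := s / 2) (by rw [hre]; linarith)
  rw [hre] at h2
  have h3 := Real.Gamma_le_of_le_natCast (u := s.re / 2) (n := n) (by linarith) hn
  calc _ ≤ 1 * ‖Complex.Gamma (s / 2)‖ := by gcongr
    _ ≤ _ := by linarith

lemma Complex.norm_Gammaℝ_two_mul_add_one (n : ℕ) :
    ‖Complex.Gammaℝ (2 * (n + 1))‖ = n.factorial / Real.pi ^ (n + 1) := by
  rw [Complex.Gammaℝ_def, mul_div_cancel_left₀ _ two_ne_zero, Complex.Gamma_nat_eq_factorial,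
    norm_mul, Complex.norm_natCast,
    show (-(2 * ((n : ℂ) + 1)) / 2) = -((n + 1 : ℕ) : ℂ) by push_cast; ring, Complex.cpow_neg,
    Complex.cpow_natCast, norm_inv, norm_pow, Complex.norm_real, Real.norm_eq_abs,
    abs_of_pos Real.pi_pos]
  field_simp

namespace DirichletCharacter

variable {q : ℕ} {χ : DirichletCharacter ℂ q}

lemma exists_gammaFactor_eq (χ : DirichletCharacter ℂ q) :
    ∃ a : ℝ, 0 ≤ a ∧ a ≤ 1 ∧ ∀ s, gammaFactor χ s = Complex.Gammaℝ (s + a) := by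
  rcases χ.even_or_odd with h | h
  · exact ⟨0, le_rfl, zero_le_one, fun s => by rw [h.gammaFactor_def]; simp⟩
  · exact ⟨1, zero_le_one, le_rfl, fun s => by rw [h.gammaFactor_def]; simp⟩

variable [NeZero q]

/-- The completed `L`-function, normalised and centred so that for a real primitive character the
functional equation relates its values at `w` and `-w`. -/
noncomputable def centredLFunction (χ : DirichletCharacter ℂ q) (w : ℂ) : ℂ :=
  (q : ℂ) ^ (w / 2) * completedLFunction χ (1 / 2 + w)

lemma differentiable_centredLFunction (hχ : χ ≠ 1) : Differentiable ℂ (centredLFunction χ) := by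
  have h : (q : ℂ) ≠ 0 := NeZero.ne _
  have h1 := differentiable_completedLFunction hχ
  unfold centredLFunction
  refine Differentiable.mul (fun w => ?_) (h1.comp (differentiable_id.const_add _))
  exact (differentiableAt_id.div_const 2).const_cpow (Or.inl h)

lemma centredLFunction_neg (hp : χ.IsPrimitive) (hr : ∀ a, (χ a).im = 0) (w : ℂ) :
    centredLFunction χ (-w) = rootNumber χ * centredLFunction χ w := by
  have h : (q : ℂ) ≠ 0 := NeZero.ne _
  unfold centredLFunction
  rw [show 1 / 2 + -w = 1 - (1 / 2 + w) by ring, completedLFunction_one_sub_of_real hp hr,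
    add_sub_cancel_left, ← mul_assoc, ← mul_assoc, ← Complex.cpow_add _ _ h,
    show -w / 2 + w = w / 2 by ring]
  ring

lemma norm_centredLFunction (hχ : χ ≠ 1) {w : ℂ} (hw : 0 ≤ w.re) :
    ‖centredLFunction χ w‖ = (q : ℝ) ^ (w.re / 2) * (‖gammaFactor χ (1 / 2 + w)‖ *
      ‖LFunction χ (1 / 2 + w)‖) := by
  unfold centredLFunction
  rw [completedLFunction_eq_mul hχ (by simp; linarith), norm_mul, norm_mul,
    Complex.norm_natCast_cpow_of_pos (NeZero.pos q)]
  simp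

lemma norm_centredLFunction_le (hχ : χ ≠ 1) {w : ℂ} {n : ℕ} (hqn : q ≤ n) (hn : 4 ≤ n)
    (hw : 0 ≤ w.re) (hwn : ‖w‖ ≤ n) :
    ‖centredLFunction χ w‖ ≤ 16 * (n : ℝ) ^ (2 * n + 2) := by
  obtain ⟨a, ha0, ha1, ha⟩ := exists_gammaFactor_eq χ
  have hre := (Complex.re_le_norm w).trans hwn
  have hn4 : (4 : ℝ) ≤ n := by exact_mod_cast hn
  have hqn' : (q : ℝ) ≤ n := by exact_mod_cast hqn
  have hq1 : (1 : ℝ) ≤ q := by exact_mod_cast NeZero.pos q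
  have h1 : (q : ℝ) ^ (w.re / 2) ≤ (n : ℝ) ^ n := by
    rw [← Real.rpow_natCast]
    calc (q : ℝ) ^ (w.re / 2) ≤ (n : ℝ) ^ (w.re / 2) := by gcongr
      _ ≤ _ := Real.rpow_le_rpow_of_exponent_le (by linarith) (by linarith)
  have hsre : (1 / 2 + w).re = 1 / 2 + w.re := by simp
  have h2 : ‖gammaFactor χ (1 / 2 + w)‖ ≤ 4 * (n : ℝ) ^ n := by
    rw [ha]
    refine Complex.norm_Gammaℝ_le ?_ ?_
    · rw [Complex.add_re, hsre, Complex.ofReal_re]; linarith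
    · rw [Complex.add_re, hsre, Complex.ofReal_re]; linarith
  have h3 : ‖LFunction χ (1 / 2 + w)‖ ≤ 4 * (n : ℝ) ^ 2 := by
    refine (norm_LFunction_le hχ (by rw [hsre]; linarith)).trans ?_
    have h4 : ‖1 / 2 + w‖ ≤ 1 / 2 + n := by
      refine (norm_add_le _ _).trans ?_
      gcongr
      norm_num
    rw [hsre, div_le_iff₀ (by linarith)]
    calc (q : ℝ) * ‖1 / 2 + w‖ ≤ n * (1 / 2 + n) := by gcongr
      _ ≤ 4 * (n : ℝ) ^ 2 * (1 / 2) := by nlinarith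
      _ ≤ _ := by gcongr; linarith
  rw [norm_centredLFunction hχ hw]
  calc _ ≤ (n : ℝ) ^ n * (4 * (n : ℝ) ^ n * (4 * (n : ℝ) ^ 2)) := by gcongr
    _ = _ := by ring

/-- The points are chosen so that the Gamma factor is `Gammaℝ` at `4` and at `20`, that is `1/π²`
and `9!/π¹⁰`. This growth beats the variation of `L` between `1/3` and `5/3`, and the power of `q`
only helps. The ratio `3` exceeds `e`, so the logarithm grows by at least `1`. -/
lemma exists_norm_centredLFunction_growth (hχ : χ ≠ 1) :
    ∃ x y : ℝ, |x| ≤ 20 ∧ |y| ≤ 20 ∧ 1 / 30 ≤ ‖centredLFunction χ x‖ ∧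
      3 * ‖centredLFunction χ x‖ ≤ ‖centredLFunction χ y‖ := by
  obtain ⟨a, ha0, ha1, ha⟩ := exists_gammaFactor_eq χ
  have hq1 : (1 : ℝ) ≤ q := by exact_mod_cast NeZero.pos q
  have hL : ∀ c : ℝ, 4 ≤ c → 1 / 3 ≤ ‖LFunction χ (1 / 2 + (c - a - 1 / 2 : ℝ))‖ ∧
      ‖LFunction χ (1 / 2 + (c - a - 1 / 2 : ℝ))‖ ≤ 5 / 3 := by
    intro c hc
    have h := norm_LFunction_sub_one_le (χ := χ) (s := 1 / 2 + (c - a - 1 / 2 : ℝ))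
      (by simp; linarith)
    set L := LFunction χ (1 / 2 + (c - a - 1 / 2 : ℝ))
    have h1 : ‖(1 : ℂ)‖ = 1 := norm_one
    constructor
    · have := norm_sub_norm_le (1 : ℂ) L
      rw [norm_sub_rev] at this
      linarith
    · have := norm_sub_norm_le L (1 : ℂ)
      linarith
  have hΓ : ∀ c : ℝ, gammaFactor χ (1 / 2 + (c - a - 1 / 2 : ℝ)) = Complex.Gammaℝ c := by
    intro c
    rw [ha]
    congr 1
    push_cast
    ring
  have hX : ∀ c : ℝ, 4 ≤ c → ‖centredLFunction χ (c - a - 1 / 2 : ℝ)‖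
      = (q : ℝ) ^ ((c - a - 1 / 2) / 2) * (‖Complex.Gammaℝ c‖ *
        ‖LFunction χ (1 / 2 + (c - a - 1 / 2 : ℝ))‖) := by
    intro c hc
    rw [norm_centredLFunction hχ (by rw [Complex.ofReal_re]; linarith), Complex.ofReal_re, hΓ]
  have h4 : ‖Complex.Gammaℝ (4 : ℝ)‖ = 1 / Real.pi ^ 2 := by
    have := Complex.norm_Gammaℝ_two_mul_add_one 1
    norm_num at this
    simpa using this
  have h20 : ‖Complex.Gammaℝ (20 : ℝ)‖ = 362880 / Real.pi ^ 10 := by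
    have := Complex.norm_Gammaℝ_two_mul_add_one 9
    norm_num [Nat.factorial] at this
    simpa using this
  have hpi : Real.pi < 3.15 := Real.pi_lt_d2
  have hpi0 := Real.pi_pos
  have hpi2 : Real.pi ^ 2 ≤ 10 := by nlinarith
  have hpi8 : Real.pi ^ 8 ≤ 10000 := by
    calc Real.pi ^ 8 = (Real.pi ^ 2) ^ 4 := by ring
      _ ≤ 10 ^ 4 := by gcongr
      _ = _ := by norm_num
  refine ⟨4 - a - 1 / 2, 20 - a - 1 / 2, abs_le.2 ⟨by linarith, by linarith⟩,
    abs_le.2 ⟨by linarith, by linarith⟩, ?_, ?_⟩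
  · rw [hX 4 le_rfl, h4]
    have h1 : 1 ≤ (q : ℝ) ^ ((4 - a - 1 / 2) / 2) := Real.one_le_rpow hq1 (by linarith)
    calc (1 : ℝ) / 30 = 1 * (1 / 10 * (1 / 3)) := by norm_num
      _ ≤ _ := by
        gcongr
        exact (hL 4 le_rfl).1
  · rw [hX 4 le_rfl, hX 20 (by norm_num), h4, h20]
    have h1 : (q : ℝ) ^ ((4 - a - 1 / 2) / 2) ≤ (q : ℝ) ^ ((20 - a - 1 / 2) / 2) :=
      Real.rpow_le_rpow_of_exponent_le hq1 (by linarith)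
    have h2 : 3 * (1 / Real.pi ^ 2 * (5 / 3)) ≤ 362880 / Real.pi ^ 10 * (1 / 3) := by
      rw [show Real.pi ^ 10 = Real.pi ^ 2 * Real.pi ^ 8 by ring]
      have : 15 ≤ 362880 / Real.pi ^ 8 := by
        rw [le_div_iff₀ (by positivity)]; linarith
      calc 3 * (1 / Real.pi ^ 2 * (5 / 3)) = 1 / Real.pi ^ 2 * (1 / 3) * 15 := by ring
        _ ≤ 1 / Real.pi ^ 2 * (1 / 3) * (362880 / Real.pi ^ 8) := by gcongr
        _ = _ := by field_simp
    calc _ ≤ (q : ℝ) ^ ((4 - a - 1 / 2) / 2) * (3 * (1 / Real.pi ^ 2 * (5 / 3))) := by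
          rw [mul_left_comm]
          gcongr
          exact (hL 4 le_rfl).2
      _ ≤ (q : ℝ) ^ ((20 - a - 1 / 2) / 2) * (362880 / Real.pi ^ 10 * (1 / 3)) := by gcongr
      _ ≤ _ := by
        gcongr
        exact (hL 20 (by norm_num)).1

/-- In the hypothesis, `51200 = 128 · 20²` comes from near-constancy on `|w| ≤ 20`, and `480 = 16 ·
30` is the upper bound's constant divided by the lower bound `1/30`. -/
lemma exists_isNontrivialZero_of_log_lt (hp : χ.IsPrimitive) (hχ : χ ≠ 1)
    (hr : ∀ a, (χ a).im = 0) {n : ℕ} (hqn : q ≤ n) (hn : 200 ≤ n)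
    (hlog : 51200 * (Real.log 480 + (2 * n + 2) * Real.log n) < (n : ℝ) ^ 2) :
    ∃ ρ, IsNontrivialZero χ ρ ∧ ‖ρ - 1 / 2‖ < n := by
  by_contra! hno
  have hn' : (200 : ℝ) ≤ n := by exact_mod_cast hn
  have hne : ∀ w ∈ Metric.ball (0 : ℂ) n, centredLFunction χ w ≠ 0 := by
    intro w hw h0
    rw [mem_ball_zero_iff] at hw
    rcases mul_eq_zero.1 h0 with h | h
    · exact (Complex.cpow_ne_zero_iff_of_exponent_ne_zero (y := w / 2) (fun h1 => by
        rw [h1, Complex.cpow_zero] at h; exact one_ne_zero h)).2 (NeZero.ne _) h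
    · have := hno _ (isNontrivialZero_of_completedLFunction_eq_zero hp hχ hr h)
      rw [add_sub_cancel_left] at this
      linarith
  -- The functional equation at the centre, where the function does not vanish by assumption, forces
  -- the sign `+1`.
  have hroot : rootNumber χ = 1 := by
    have h0 := hne 0 (Metric.mem_ball_self (by linarith))
    have h1 := centredLFunction_neg hp hr (χ := χ) 0
    rw [neg_zero] at h1
    exact (mul_eq_right₀ h0).1 h1.symm
  have heven : ∀ w, centredLFunction χ (-w) = centredLFunction χ w := fun w => by
    rw [centredLFunction_neg hp hr, hroot, one_mul]
  have hbd : ∀ w ∈ Metric.ball (0 : ℂ) n, ‖centredLFunction χ w‖ ≤ 16 * (n : ℝ) ^ (2 * n + 2) := by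
    intro w hw
    rw [mem_ball_zero_iff] at hw
    rcases le_total 0 w.re with h | h
    · exact norm_centredLFunction_le hχ hqn (by omega) h hw.le
    · rw [← heven]
      exact norm_centredLFunction_le hχ hqn (by omega) (by simpa using h) (by simpa using hw.le)
  obtain ⟨x, y, hx, hy, hlow, hgrow⟩ := exists_norm_centredLFunction_growth hχ
  have hxpos : 0 < ‖centredLFunction χ x‖ := by linarith
  set A := Real.log 480 + (2 * n + 2) * Real.log n with hA
  have hlogn : 0 ≤ Real.log n := Real.log_nonneg (by linarith)
  have hApos : 0 < A := by
    have : 0 < Real.log 480 := Real.log_pos (by norm_num)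
    positivity
  have h := Complex.abs_log_norm_sub_le_of_even (differentiable_centredLFunction hχ) heven
    (R := n) (r := 20) (A := A) (x := x) (y := y) (by norm_num) (by linarith) hne
    (by simpa using hx) (by simpa using hy) hApos (fun w hw => by
      rw [← Real.log_div (norm_ne_zero_iff.2 (hne w hw)) hxpos.ne']
      have h1 : A = Real.log (480 * (n : ℝ) ^ (2 * n + 2)) := by
        rw [Real.log_mul (by norm_num) (by positivity), Real.log_pow]
        push_cast
        rfl
      rw [h1]
      refine Real.log_le_log (div_pos (norm_pos_iff.2 (hne w hw)) hxpos) ?_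
      rw [div_le_iff₀ hxpos]
      calc _ ≤ 16 * (n : ℝ) ^ (2 * n + 2) := hbd w hw
        _ = 480 * (n : ℝ) ^ (2 * n + 2) * (1 / 30) := by ring
        _ ≤ _ := by gcongr)
  have h3 : 1 ≤ Real.log ‖centredLFunction χ y‖ - Real.log ‖centredLFunction χ x‖ := by
    rw [← Real.log_div (by linarith) hxpos.ne', Real.le_log_iff_exp_le (by
      apply div_pos <;> linarith), le_div_iff₀ hxpos]
    have := Real.exp_one_lt_d9
    nlinarith
  have h4 : 128 * A * (20 / (n : ℝ)) ^ 2 < 1 := by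
    rw [div_pow, ← mul_div_assoc, div_lt_one (by positivity)]
    linarith
  linarith [le_abs_self (Real.log ‖centredLFunction χ y‖ - Real.log ‖centredLFunction χ x‖)]

end DirichletCharacter

/-- The lowest nontrivial zero of a real primitive `L`-function has height at most linear in the
modulus, with an absolute constant. -/
theorem exists_isNontrivialZero_norm_lt : ∃ N : ℕ, ∀ (q : ℕ) [NeZero q] (χ : DirichletCharacter ℂ q),
    χ.IsPrimitive → χ ≠ 1 → (∀ a : ZMod q, (χ a).im = 0) →
      ∃ ρ, IsNontrivialZero χ ρ ∧ ‖ρ - 1 / 2‖ < (N + q : ℕ) := by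
  -- Here `n log n = o(n²)`, with no dependence on `q`: hence one `N` for all characters.
  have hlim : ∀ᶠ n : ℕ in atTop,
      51200 * (Real.log 480 + (2 * n + 2) * Real.log n) < (n : ℝ) ^ 2 := by
    have h1 : Tendsto (fun n : ℕ => Real.log n / n) atTop (nhds 0) := by
      have := Real.isLittleO_log_id_atTop.tendsto_div_nhds_zero
      exact this.comp tendsto_natCast_atTop_atTop
    have h2 : Tendsto (fun n : ℕ => (n : ℝ)⁻¹) atTop (nhds 0) := tendsto_inv_atTop_nhds_zero_nat
    have h3 : Tendsto (fun n : ℕ => 51200 * (Real.log 480 * ((n : ℝ)⁻¹ * (n : ℝ)⁻¹)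
        + (2 + 2 * (n : ℝ)⁻¹) * (Real.log n / n))) atTop (nhds 0) := by
      have := (((h2.mul h2).const_mul (Real.log 480)).add
        (((h2.const_mul 2).const_add 2).mul h1)).const_mul 51200
      simpa using this
    filter_upwards [h3.eventually_lt_const one_pos, eventually_gt_atTop 0] with n hn hn0
    have hn' : (0 : ℝ) < n := by exact_mod_cast hn0
    have := mul_lt_mul_of_pos_right hn (pow_pos hn' 2)
    rw [one_mul] at this
    refine lt_of_eq_of_lt ?_ this
    field_simp
  obtain ⟨N, hN⟩ := eventually_atTop.1 (hlim.and (eventually_ge_atTop 200))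
  refine ⟨N, fun q _ χ hp hχ hr => ?_⟩
  obtain ⟨h1, h2⟩ := hN (N + q) (by omega)
  exact DirichletCharacter.exists_isNontrivialZero_of_log_lt hp hχ hr (by omega) h2 h1

/-! ### Angles and distances -/

lemma exists_odd_pi_mul_div_mem_Ioo {x y : ℝ} (hx : 0 ≤ x) (hxy : x < y) :
    ∃ a b : ℕ, Odd b ∧ x < Real.pi * a / b ∧ Real.pi * a / b < y := by
  have hpi := Real.pi_pos
  obtain ⟨m, hm⟩ := exists_nat_gt (Real.pi / (y - x))
  have hyx : 0 < y - x := sub_pos.2 hxy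
  rw [div_lt_iff₀ hyx] at hm
  have hm0 : (0 : ℝ) ≤ m := by positivity
  refine ⟨⌊x * (2 * m + 1 : ℕ) / Real.pi⌋₊ + 1, 2 * m + 1, odd_two_mul_add_one m, ?_, ?_⟩
  · rw [lt_div_iff₀ (by positivity)]
    have := Nat.lt_floor_add_one (x * (2 * m + 1 : ℕ) / Real.pi)
    rw [div_lt_iff₀ hpi] at this
    push_cast at this ⊢
    linarith
  · rw [div_lt_iff₀ (by positivity)]
    have := Nat.floor_le (a := x * (2 * m + 1 : ℕ) / Real.pi) (by positivity)
    rw [le_div_iff₀ hpi] at this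
    push_cast at this ⊢
    nlinarith

lemma Complex.arg_eq_arctan_of_re_pos {w : ℂ} (hw : 0 < w.re) :
    w.arg = Real.arctan (w.im / w.re) := by
  have h := Complex.abs_arg_lt_pi_div_two_iff.2 (Or.inl hw)
  rw [abs_lt] at h
  rw [← Complex.tan_arg, Real.arctan_tan h.1 h.2]

lemma Complex.norm_ofReal_sub_sq (s : ℝ) (z : ℂ) :
    ‖(s : ℂ) - z‖ ^ 2 = (s - z.re) ^ 2 + z.im ^ 2 := by
  rw [Complex.sq_norm, Complex.normSq_apply]
  simp
  ring

lemma Complex.norm_ofReal_sub_conj (s : ℝ) (z : ℂ) :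
    ‖(s : ℂ) - starRingEnd ℂ z‖ = ‖(s : ℂ) - z‖ := by
  rw [← Complex.norm_conj ((s : ℂ) - z), map_sub, Complex.conj_ofReal]

lemma Complex.eq_or_eq_conj {z w : ℂ} (hre : z.re = w.re) (him : |z.im| = |w.im|) :
    z = w ∨ z = starRingEnd ℂ w := by
  rcases abs_eq_abs.1 him with h | h
  · exact Or.inl (Complex.ext hre h)
  · exact Or.inr (Complex.ext (by simpa using hre) (by simpa using h))

/-- The slope of the distance is the cosine of the angle under which `z` is seen, so a prescribed
angle becomes a condition for a critical point. -/
lemma Complex.hasDerivAt_norm_ofReal_sub {s : ℝ} {z : ℂ} (h : (s : ℂ) ≠ z) :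
    HasDerivAt (fun x : ℝ => ‖(x : ℂ) - z‖) ((s - z.re) / ‖(s : ℂ) - z‖) s := by
  have hpos : 0 < ‖(s : ℂ) - z‖ := norm_pos_iff.2 (sub_ne_zero.2 h)
  have hf : (fun x : ℝ => ‖(x : ℂ) - z‖) = fun x : ℝ => √((x - z.re) ^ 2 + z.im ^ 2) := by
    ext x
    rw [← Complex.norm_ofReal_sub_sq, Real.sqrt_sq (norm_nonneg _)]
  have hd : HasDerivAt (fun x : ℝ => (x - z.re) ^ 2 + z.im ^ 2) (2 * (s - z.re)) s := by
    have := (((hasDerivAt_id s).sub_const z.re).pow 2).add_const (z.im ^ 2)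
    simpa using this
  have hne : (s - z.re) ^ 2 + z.im ^ 2 ≠ 0 := by
    rw [← Complex.norm_ofReal_sub_sq]; positivity
  have := hd.sqrt hne
  rw [hf]
  rw [← Complex.norm_ofReal_sub_sq, Real.sqrt_sq (norm_nonneg _)] at this
  convert this using 1
  field_simp

/-! ### Sign sequences determined by the nearest zero -/

/-- `ρ` and its conjugate are the only zeros of `L(·, χ)` nearest to `s`. -/
def IsNearestZero {q : ℕ} [NeZero q] (χ : DirichletCharacter ℂ q) (s : ℝ) (ρ : ℂ) : Prop :=
  χ.LFunction ρ = 0 ∧ ∀ z, χ.LFunction z = 0 → ‖(s : ℂ) - z‖ ≤ ‖(s : ℂ) - ρ‖ →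
    z = ρ ∨ z = starRingEnd ℂ ρ

namespace IsNearestZero

variable {q : ℕ} [NeZero q] {χ : DirichletCharacter ℂ q}

lemma exists_tendsto (hχ : χ ≠ 1) (hr : ∀ a, (χ a).im = 0) {s : ℝ} {ρ : ℂ}
    (h : IsNearestZero χ s ρ) (hs : 1 < s) :
    ∃ c > 0, Tendsto (fun k : ℕ => (-1) ^ k * ‖(s : ℂ) - ρ‖ ^ (k + 1) / k.factorial
      * iteratedDeriv (k + 1) (logL χ) s
      - c * Real.cos ((k + 1) * ((s : ℂ) - ρ).arg)) atTop (nhds 0) := by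
  refine exists_tendsto_iteratedDeriv_log (DirichletCharacter.differentiable_LFunction hχ) ?_ h.1 h.2
  filter_upwards [Ioi_mem_nhds hs] with x hx
  exact DirichletCharacter.LFunction_ofReal_pos hr hx

lemma ofReal_ne (hχ : χ ≠ 1) {s : ℝ} {ρ : ℂ} (h : IsNearestZero χ s ρ) (hs : 1 < s) :
    (s : ℂ) ≠ ρ := by
  rintro h1
  exact DirichletCharacter.LFunction_ne_zero_of_one_le_re χ (Or.inl hχ)
    (by rw [← h1, Complex.ofReal_re]; exact hs.le) h.1

lemma factor_pos (hχ : χ ≠ 1) {s : ℝ} {ρ : ℂ} (h : IsNearestZero χ s ρ) (hs : 1 < s) (k : ℕ) :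
    0 < ‖(s : ℂ) - ρ‖ ^ (k + 1) / k.factorial := by
  have := norm_pos_iff.2 (sub_ne_zero.2 (h.ofReal_ne hχ hs))
  positivity

lemma signSeq_ne (hχ : χ ≠ 1) (hr : ∀ a, (χ a).im = 0) {s s' : ℝ} {ρ ρ' : ℂ}
    (h : IsNearestZero χ s ρ) (h' : IsNearestZero χ s' ρ') (hs : 1 < s) (hs' : 1 < s')
    (h0 : 0 < ((s : ℂ) - ρ).arg) (h1 : ((s : ℂ) - ρ).arg < Real.pi / 2)
    (h0' : 0 < ((s' : ℂ) - ρ').arg) (h1' : ((s' : ℂ) - ρ').arg < Real.pi / 2)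
    (hne : ((s : ℂ) - ρ).arg ≠ ((s' : ℂ) - ρ').arg) : signSeq χ s ≠ signSeq χ s' := by
  intro heq
  obtain ⟨c, hc, hu⟩ := h.exists_tendsto hχ hr hs
  obtain ⟨c', hc', hu'⟩ := h'.exists_tendsto hχ hr hs'
  refine not_eventually_sign_eq h0 h1 h0' h1' hne hc hc' hu hu' ?_
  have hev := Germ.coe_eq.1 heq
  filter_upwards [(tendsto_add_atTop_nat 1).eventually hev] with k hk
  have hf := h.factor_pos hχ hs k
  have hf' := h'.factor_pos hχ hs' k
  have hprod : 0 ≤ iteratedDeriv (k + 1) (logL χ) s * iteratedDeriv (k + 1) (logL χ) s' := by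
    rw [← sign_nonneg_iff, sign_mul, hk]
    generalize SignType.sign (iteratedDeriv (k + 1) (logL χ) s') = σ
    cases σ <;> decide
  -- The alternating factors of the two asymptotics cancel in the product.
  have hsq : ((-1 : ℝ) ^ k) * (-1) ^ k = 1 := by
    rw [← mul_pow]; norm_num
  calc 0 ≤ (‖(s : ℂ) - ρ‖ ^ (k + 1) / k.factorial * (‖(s' : ℂ) - ρ'‖ ^ (k + 1) / k.factorial))
        * (iteratedDeriv (k + 1) (logL χ) s * iteratedDeriv (k + 1) (logL χ) s') := by positivity
    _ = (((-1 : ℝ) ^ k) * (-1) ^ k) *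
        ((‖(s : ℂ) - ρ‖ ^ (k + 1) / k.factorial * (‖(s' : ℂ) - ρ'‖ ^ (k + 1) / k.factorial))
        * (iteratedDeriv (k + 1) (logL χ) s * iteratedDeriv (k + 1) (logL χ) s')) := by
          rw [hsq, one_mul]
    _ = _ := by ring

lemma eventually_sign_eq (hχ : χ ≠ 1) (hr : ∀ a, (χ a).im = 0) {s : ℝ} {ρ : ℂ} {a b : ℕ}
    (h : IsNearestZero χ s ρ) (hs : 1 < s) (hb : Odd b)
    (harg : ((s : ℂ) - ρ).arg = Real.pi * a / b) :
    ∀ᶠ k : ℕ in atTop, SignType.sign (iteratedDeriv (k + 1) (logL χ) s)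
      = SignType.sign ((-1 : ℝ) ^ k) * SignType.sign (Real.cos ((k + 1) * (Real.pi * a / b))) := by
  obtain ⟨c, hc, hu⟩ := h.exists_tendsto hχ hr hs
  rw [harg] at hu
  filter_upwards [eventually_sign_eq_of_tendsto hb hc hu] with k hk
  have hf := h.factor_pos hχ hs k
  rw [← hk, mul_div_assoc, mul_assoc, sign_mul, sign_mul, sign_pos hf, one_mul, ← mul_assoc,
    ← sign_mul]
  have hsq : ((-1 : ℝ) ^ k) * (-1) ^ k = 1 := by
    rw [← mul_pow]; norm_num
  rw [hsq, sign_one, one_mul]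

/-- At an angle `πa/b` with `b` odd, neither the distance nor the multiplicity of the nearest zero
affects the eventual signs. -/
lemma signSeq_eq (hχ : χ ≠ 1) (hr : ∀ a, (χ a).im = 0) {s s' : ℝ} {ρ ρ' : ℂ} {a b : ℕ}
    (h : IsNearestZero χ s ρ) (h' : IsNearestZero χ s' ρ') (hs : 1 < s) (hs' : 1 < s') (hb : Odd b)
    (harg : ((s : ℂ) - ρ).arg = Real.pi * a / b)
    (harg' : ((s' : ℂ) - ρ').arg = Real.pi * a / b) : signSeq χ s = signSeq χ s' := by
  refine Germ.coe_eq.2 ?_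
  have key : ∀ᶠ k : ℕ in atTop, SignType.sign (iteratedDeriv (k + 1) (logL χ) s)
      = SignType.sign (iteratedDeriv (k + 1) (logL χ) s') := by
    filter_upwards [h.eventually_sign_eq hχ hr hs hb harg, h'.eventually_sign_eq hχ hr hs' hb harg']
      with k h1 h2
    rw [h1, h2]
  obtain ⟨N, hN⟩ := eventually_atTop.1 key
  refine eventually_atTop.2 ⟨N + 1, fun k hk => ?_⟩
  obtain ⟨m, rfl⟩ := Nat.exists_eq_add_of_le' hk
  exact hN (m + N) (by omega)

end IsNearestZero

/-! ### The lowest zero is the nearest; injectivity under RH -/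

namespace DirichletCharacter

variable {q : ℕ} [NeZero q] {χ : DirichletCharacter ℂ q}

/-- Assuming that the zeros of height at most `n` lie on the critical line, there is a lowest zero
on that line. -/
lemma exists_lowest_zero (hχ : χ ≠ 1) (hr : ∀ a, (χ a).im = 0) {n : ℝ}
    (hex : ∃ ρ, IsNontrivialZero χ ρ ∧ ‖ρ - 1 / 2‖ < n) (hRH : RiemannHypothesisUpTo χ n) :
    ∃ ρ, χ.LFunction ρ = 0 ∧ ρ.re = 1 / 2 ∧ ρ.im ≤ 0 ∧ |ρ.im| < n ∧
      ∀ z, χ.LFunction z = 0 → z.re = 1 / 2 → |ρ.im| ≤ |z.im| := by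
  obtain ⟨ρ₀, h₀, h₁⟩ := hex
  have him₀ : |ρ₀.im| < n := by
    have := Complex.abs_im_le_norm (ρ₀ - 1 / 2)
    simp only [Complex.sub_im] at this
    norm_num at this
    linarith
  have hre₀ := hRH ρ₀ h₀ him₀.le
  set K : Set ℂ := {z | χ.LFunction z = 0 ∧ z.re = 1 / 2 ∧ |z.im| ≤ |ρ₀.im|} with hK
  have hKc : IsCompact K := by
    refine (isCompact_closedBall (1 / 2 : ℂ) |ρ₀.im|).of_isClosed_subset ?_ ?_
    · exact (isClosed_eq (differentiable_LFunction hχ).continuous continuous_const).inter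
        ((isClosed_eq Complex.continuous_re continuous_const).inter
          (isClosed_le Complex.continuous_im.abs continuous_const))
    · rintro z ⟨-, h2, h3⟩
      rw [Metric.mem_closedBall, dist_eq_norm]
      refine (Complex.norm_le_abs_re_add_abs_im _).trans ?_
      simp [h2, h3]
  obtain ⟨ρ, ⟨hρ0, hρre, hρim⟩, hmin⟩ := hKc.exists_isMinOn ⟨ρ₀, h₀.1, hre₀, le_rfl⟩
    Complex.continuous_im.abs.continuousOn
  have hlow : ∀ z, χ.LFunction z = 0 → z.re = 1 / 2 → |ρ.im| ≤ |z.im| := by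
    intro z hz hzre
    rcases le_total |z.im| |ρ₀.im| with h | h
    · exact hmin ⟨hz, hzre, h⟩
    · exact hρim.trans h
  -- Of a conjugate pair the lower member is kept, so that `s - ρ` has nonnegative argument.
  rcases le_total ρ.im 0 with h | h
  · exact ⟨ρ, hρ0, hρre, h, by linarith, hlow⟩
  · refine ⟨starRingEnd ℂ ρ, by rw [LFunction_conj hχ hr, hρ0, map_zero], by simpa using hρre,
      by simpa using h, ?_, ?_⟩
    · rw [Complex.conj_im, abs_neg]; linarith
    · rw [Complex.conj_im, abs_neg]; exact hlow

/-- A zero off the critical line has a reflection that is closer to each real `s > 1 / 2`, or lies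
to the right of the line itself. -/
lemma exists_re_gt_half_norm_le (hp : χ.IsPrimitive) (hχ : χ ≠ 1) (hr : ∀ a, (χ a).im = 0) {z : ℂ}
    (hz : IsNontrivialZero χ z) (hre : z.re ≠ 1 / 2) :
    ∃ z', IsNontrivialZero χ z' ∧ 1 / 2 < z'.re ∧ z'.im = z.im ∧
      ∀ s : ℝ, 1 / 2 ≤ s → ‖(s : ℂ) - z'‖ ≤ ‖(s : ℂ) - z‖ := by
  rcases lt_or_gt_of_ne hre with h | h
  · refine ⟨1 - starRingEnd ℂ z, isNontrivialZero_one_sub hp hχ hr (isNontrivialZero_conj hχ hr hz),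
      by simp; linarith, by simp, fun s hs => ?_⟩
    rw [← abs_of_nonneg (norm_nonneg ((s : ℂ) - z)), ← abs_of_nonneg (norm_nonneg (_ - _)),
      ← sq_le_sq, Complex.norm_ofReal_sub_sq, Complex.norm_ofReal_sub_sq]
    simp
    nlinarith
  · exact ⟨z, hz, h, rfl, fun s _ => le_rfl⟩

/-- Comparing with `s²` requires only `ρ.im ^ 2 + 1/4 < s`; this is where the threshold `n ^ 2 + 2`
originates. -/
lemma norm_ofReal_sub_lt_of_trivial {n s : ℝ} {ρ z : ℂ} (hre : ρ.re = 1 / 2)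
    (him : |ρ.im| < n) (hs : n ^ 2 + 2 ≤ s) (hz : z.im = 0 ∧ z.re ≤ 0) :
    ‖(s : ℂ) - ρ‖ < ‖(s : ℂ) - z‖ := by
  rw [← abs_of_nonneg (norm_nonneg ((s : ℂ) - z)), ← abs_of_nonneg (norm_nonneg (_ - _)),
      ← sq_lt_sq, Complex.norm_ofReal_sub_sq, Complex.norm_ofReal_sub_sq, hre, hz.1]
  have h1 : ρ.im ^ 2 ≤ n ^ 2 := sq_le_sq' (by linarith [abs_lt.1 him]) (by linarith [abs_lt.1 him])
  nlinarith [hz.2, sq_nonneg n]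

/-- If every zero to the right of the critical line is farther from `s` than the lowest zero, then
the lowest zero is the nearest one. -/
lemma isNearestZero_of_forall_lt (hp : χ.IsPrimitive) (hχ : χ ≠ 1) (hr : ∀ a, (χ a).im = 0)
    {n s : ℝ} {ρ : ℂ} (hρ : χ.LFunction ρ = 0) (hre : ρ.re = 1 / 2) (him : |ρ.im| < n)
    (hlow : ∀ z, χ.LFunction z = 0 → z.re = 1 / 2 → |ρ.im| ≤ |z.im|) (hs : n ^ 2 + 2 ≤ s)
    (hright : ∀ z, IsNontrivialZero χ z → 1 / 2 < z.re → ‖(s : ℂ) - ρ‖ < ‖(s : ℂ) - z‖) :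
    IsNearestZero χ s ρ := by
  refine ⟨hρ, fun z hz hle => ?_⟩
  rcases isNontrivialZero_or_of_LFunction_eq_zero hp hχ hr hz with h | h
  · by_cases hzre : z.re = 1 / 2
    · refine Complex.eq_or_eq_conj (hzre.trans hre.symm) (le_antisymm ?_ (hlow z hz hzre))
      rw [← sq_le_sq₀ (norm_nonneg _) (norm_nonneg _), Complex.norm_ofReal_sub_sq,
        Complex.norm_ofReal_sub_sq, hre, hzre, add_le_add_iff_left] at hle
      exact sq_le_sq.1 hle
    · obtain ⟨z', h1, h2, -, h3⟩ := exists_re_gt_half_norm_le hp hχ hr h hzre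
      have := hright z' h1 h2
      have := h3 s (by nlinarith [sq_nonneg n])
      linarith
  · linarith [norm_ofReal_sub_lt_of_trivial hre him hs h]

lemma injOn_signSeq (hp : χ.IsPrimitive) (hχ : χ ≠ 1) (hr : ∀ a, (χ a).im = 0) {n : ℝ}
    (hex : ∃ ρ, IsNontrivialZero χ ρ ∧ ‖ρ - 1 / 2‖ < n) (hRH : RiemannHypothesisFor χ)
    (hhalf : χ.LFunction (1 / 2) ≠ 0) : Set.InjOn (signSeq χ) (Set.Ici (n ^ 2 + 2)) := by
  obtain ⟨ρ, hρ0, hre, hle, him, hlow⟩ :=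
    exists_lowest_zero hχ hr hex (fun z hz _ => hRH z hz)
  have hneg : ρ.im < 0 := by
    refine lt_of_le_of_ne hle fun h => hhalf ?_
    rw [← hρ0]
    congr 1
    exact Complex.ext (by simp [hre]) (by simp [h])
  have hnear : ∀ s : ℝ, n ^ 2 + 2 ≤ s → IsNearestZero χ s ρ := fun s hs =>
    isNearestZero_of_forall_lt hp hχ hr hρ0 hre him hlow hs fun z hz h => absurd (hRH z hz) h.ne'
  have hgt : ∀ s : ℝ, n ^ 2 + 2 ≤ s → 1 < s := fun s hs => by nlinarith [sq_nonneg n]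
  have hwre : ∀ s : ℝ, ((s : ℂ) - ρ).re = s - 1 / 2 := fun s => by simp [hre]
  have hwim : ∀ s : ℝ, ((s : ℂ) - ρ).im = -ρ.im := fun s => by simp
  have harg : ∀ s : ℝ, 1 < s → ((s : ℂ) - ρ).arg = Real.arctan (-ρ.im / (s - 1 / 2)) := by
    intro s hs
    rw [Complex.arg_eq_arctan_of_re_pos (by rw [hwre]; linarith), hwre, hwim]
  intro s hs s' hs' heq
  by_contra hne
  have h1 := hgt s hs
  have h1' := hgt s' hs'
  refine (hnear s hs).signSeq_ne hχ hr (hnear s' hs') h1 h1' ?_ ?_ ?_ ?_ ?_ heq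
  · rw [harg s h1, Real.arctan_pos]; exact div_pos (by linarith) (by linarith)
  · rw [harg s h1]; exact Real.arctan_lt_pi_div_two _
  · rw [harg s' h1', Real.arctan_pos]; exact div_pos (by linarith) (by linarith)
  · rw [harg s' h1']; exact Real.arctan_lt_pi_div_two _
  · rw [harg s h1, harg s' h1']
    intro h
    have h2 := Real.arctan_injective h
    have h3 : s - 1 / 2 ≠ 0 := by linarith
    have h4 : s' - 1 / 2 ≠ 0 := by linarith
    rw [div_eq_div_iff h3 h4] at h2
    have := mul_left_cancel₀ (by linarith : -ρ.im ≠ 0) h2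
    exact hne (by linarith)

end DirichletCharacter

/-! ### Injectivity excludes zeros off the critical line -/

namespace DirichletCharacter

variable {q : ℕ} [NeZero q] {χ : DirichletCharacter ℂ q}

lemma finite_zeros_closedBall (hχ : χ ≠ 1) (R : ℝ) :
    ({z | χ.LFunction z = 0} ∩ Metric.closedBall 0 R).Finite := by
  by_contra hinf
  obtain ⟨a, -, ha⟩ := Set.Infinite.exists_accPt_of_subset_isCompact hinf
    (isCompact_closedBall (0 : ℂ) R) Set.inter_subset_right
  have hd := differentiable_LFunction hχ
  have han : AnalyticOnNhd ℂ (LFunction χ) Set.univ := fun z _ => hd.analyticAt z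
  have hfreq : ∃ᶠ z in nhdsWithin a {a}ᶜ, χ.LFunction z = 0 :=
    (accPt_iff_frequently_nhdsNE.1 ha).mono fun z hz => hz.1
  have h2 := han.eqOn_zero_of_preconnected_of_frequently_eq_zero isPreconnected_univ
    (Set.mem_univ a) hfreq (Set.mem_univ (2 : ℂ))
  exact LFunction_ne_zero_of_one_le_re χ (Or.inl hχ) (s := 2) (by norm_num) h2

/-- To the right of a point `s₀` at which the distance to some zero has slope less than `c < 1`,
there is a point at which all nearest zeros are seen under an angle of cosine `c`. -/
lemma exists_isNearestZero_cos_arg (hχ : χ ≠ 1) (hr : ∀ a, (χ a).im = 0) {s₀ c : ℝ} {ρ : ℂ}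
    (hs₀ : 1 < s₀) (hρ : χ.LFunction ρ = 0)
    (hmin : ∀ z, χ.LFunction z = 0 → ‖(s₀ : ℂ) - ρ‖ ≤ ‖(s₀ : ℂ) - z‖)
    (hc : (s₀ - ρ.re) / ‖(s₀ : ℂ) - ρ‖ < c) (hc1 : c < 1) :
    ∃ s z, s₀ < s ∧ z.im ≤ 0 ∧ IsNearestZero χ s z ∧ Real.cos ((s : ℂ) - z).arg = c := by
  have hzre : ∀ z, χ.LFunction z = 0 → z.re < 1 := fun z hz => by
    by_contra! h
    exact LFunction_ne_zero_of_one_le_re χ (Or.inl hχ) h hz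
  have hne : ∀ (s : ℝ) z, 1 < s → χ.LFunction z = 0 → (s : ℂ) ≠ z := by
    rintro s z hs hz rfl
    have := hzre _ hz
    rw [Complex.ofReal_re] at this
    linarith
  have hre_le : ∀ (s : ℝ) (z : ℂ), s - z.re ≤ ‖(s : ℂ) - z‖ := fun s z => by
    have := Complex.re_le_norm ((s : ℂ) - z)
    simpa using this
  have hc0 : 0 < c := by
    refine lt_of_le_of_lt ?_ hc
    have := hzre ρ hρ
    exact div_nonneg (by linarith) (norm_nonneg _)
  set v := ‖(s₀ : ℂ) - ρ‖ - c * s₀ with hv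
  set S := (v + 1) / (1 - c) with hS
  have h1c : 0 < 1 - c := by linarith
  -- The function `‖s - z‖ - c s` is minimised jointly over `s ≥ s₀` and all zeros `z`. Since `Re z
  -- < 1`, it is at least `(1 - c)s - 1`, which bounds `s` and then `z` on a sublevel set.
  set K : Set (ℝ × ℂ) := {p | (s₀ ≤ p.1 ∧ χ.LFunction p.2 = 0) ∧ ‖(p.1 : ℂ) - p.2‖ - c * p.1 ≤ v}
    with hK
  have hcont : Continuous fun p : ℝ × ℂ => ‖(p.1 : ℂ) - p.2‖ - c * p.1 := by fun_prop
  have hKc : IsCompact K := by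
    refine ((isCompact_Icc (a := s₀) (b := S)).prod
      (isCompact_closedBall (0 : ℂ) (v + 2 * S))).of_isClosed_subset ?_ ?_
    · exact ((isClosed_le continuous_const continuous_fst).inter
        (isClosed_eq ((differentiable_LFunction hχ).continuous.comp continuous_snd)
          continuous_const)).inter (isClosed_le hcont continuous_const)
    · rintro ⟨s, z⟩ ⟨⟨h1, h2⟩, h3⟩
      simp only at h1 h2 h3
      have h4 := hre_le s z
      have h5 := hzre z h2
      have hsS : s ≤ S := by
        rw [hS, le_div_iff₀ h1c]; linarith
      refine ⟨⟨h1, hsS⟩, ?_⟩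
      rw [mem_closedBall_zero_iff]
      have h6 : ‖z‖ ≤ ‖(s : ℂ)‖ + ‖(s : ℂ) - z‖ := by
        rw [norm_sub_rev]
        exact norm_le_norm_add_norm_sub' z s
      rw [Complex.norm_real, Real.norm_eq_abs, abs_of_pos (by linarith)] at h6
      nlinarith
  obtain ⟨⟨s₂, z₂⟩, ⟨⟨hs₂, hz₂⟩, hv₂⟩, hmin₂⟩ := hKc.exists_isMinOn
    ⟨(s₀, ρ), ⟨le_rfl, hρ⟩, le_rfl⟩ hcont.continuousOn
  simp only at hs₂ hz₂ hv₂
  have hglob : ∀ (s : ℝ) z, s₀ ≤ s → χ.LFunction z = 0 →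
      ‖(s₂ : ℂ) - z₂‖ - c * s₂ ≤ ‖(s : ℂ) - z‖ - c * s := by
    intro s z hs hz
    rcases le_total (‖(s : ℂ) - z‖ - c * s) v with h | h
    · exact hmin₂ (show (s, z) ∈ K from ⟨⟨hs, hz⟩, h⟩)
    · exact hv₂.trans h
  have hderiv : ∀ (s : ℝ) z, 1 < s → χ.LFunction z = 0 →
      HasDerivAt (fun x : ℝ => ‖(x : ℂ) - z‖ - c * x) ((s - z.re) / ‖(s : ℂ) - z‖ - c) s := by
    intro s z hs hz
    have := (Complex.hasDerivAt_norm_ofReal_sub (hne s z hs hz)).fun_sub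
      ((hasDerivAt_id' s).const_mul c)
    simpa using this
  -- The slope at `s₀` along the zero `ρ` is negative, so the minimum is not at the endpoint.
  have hlt : s₀ < s₂ := by
    refine lt_of_le_of_ne hs₂ fun h => ?_
    have hd := hderiv s₀ ρ hs₀ hρ
    have hneg : (s₀ - ρ.re) / ‖(s₀ : ℂ) - ρ‖ - c < 0 := by linarith
    have hmin' : IsMinOn (fun x : ℝ => ‖(x : ℂ) - ρ‖ - c * x) (Set.Ici s₀) s₀ := by
      intro x hx
      have h1 := hglob x ρ hx hρ
      rw [← h] at h1
      have h2 := hmin z₂ hz₂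
      simp only [Set.mem_ofPred_eq]
      linarith
    have hsl : Tendsto (slope (fun x : ℝ => ‖(x : ℂ) - ρ‖ - c * x) s₀) (nhdsWithin s₀ (Set.Ioi s₀))
        (nhds ((s₀ - ρ.re) / ‖(s₀ : ℂ) - ρ‖ - c)) :=
      (hasDerivAt_iff_tendsto_slope.1 hd).mono_left
        (nhdsWithin_mono _ fun x hx => (Set.mem_Ioi.1 hx).ne')
    obtain ⟨x, hx, hx0⟩ := ((hsl.eventually_lt_const hneg).and self_mem_nhdsWithin).exists
    have hx0' : s₀ < x := hx0
    have h3 := hmin' (show x ∈ Set.Ici s₀ from hx0'.le)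
    simp only [Set.mem_ofPred_eq] at h3
    rw [slope_def_field, div_lt_iff₀ (by linarith), zero_mul] at hx
    linarith
  have h1s₂ : 1 < s₂ := hs₀.trans hlt
  -- Every zero nearest to `s₂` attains the same interior minimum, so its distance has slope exactly
  -- `c`. All of them share their real part and distance, which leaves one conjugate pair.
  have hnear : ∀ z, χ.LFunction z = 0 → ‖(s₂ : ℂ) - z‖ ≤ ‖(s₂ : ℂ) - z₂‖ →
      s₂ - z.re = c * ‖(s₂ : ℂ) - z₂‖ ∧ ‖(s₂ : ℂ) - z‖ = ‖(s₂ : ℂ) - z₂‖ := by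
    intro z hz hle
    have heq : ‖(s₂ : ℂ) - z‖ = ‖(s₂ : ℂ) - z₂‖ :=
      le_antisymm hle (by linarith [hglob s₂ z hlt.le hz])
    have hloc : IsLocalMin (fun x : ℝ => ‖(x : ℂ) - z‖ - c * x) s₂ := by
      filter_upwards [Ioi_mem_nhds hlt] with x hx
      rw [heq]
      exact hglob x z (Set.mem_Ioi.1 hx).le hz
    have h0 := hloc.hasDerivAt_eq_zero (hderiv s₂ z h1s₂ hz)
    have hpos : 0 < ‖(s₂ : ℂ) - z‖ := norm_pos_iff.2 (sub_ne_zero.2 (hne s₂ z h1s₂ hz))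
    refine ⟨?_, heq⟩
    rw [← heq, ← div_eq_iff hpos.ne']
    linarith
  have hpair : ∀ w, χ.LFunction w = 0 → ‖(s₂ : ℂ) - w‖ = ‖(s₂ : ℂ) - z₂‖ → IsNearestZero χ s₂ w ∧
      Real.cos ((s₂ : ℂ) - w).arg = c := by
    intro w hw hwn
    have hw' := (hnear w hw hwn.le).1
    refine ⟨⟨hw, fun z hz hle => ?_⟩, ?_⟩
    · obtain ⟨h1, h2⟩ := hnear z hz (hle.trans hwn.le)
      have hre : z.re = w.re := by linarith
      refine Complex.eq_or_eq_conj hre ?_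
      have h3 := Complex.norm_ofReal_sub_sq s₂ z
      rw [h2, ← hwn, Complex.norm_ofReal_sub_sq, hre, add_right_inj] at h3
      exact (sq_eq_sq_iff_abs_eq_abs _ _).1 h3.symm
    · have hw0 := sub_ne_zero.2 (hne s₂ w h1s₂ hw)
      rw [Complex.cos_arg hw0, div_eq_iff (norm_ne_zero_iff.2 hw0), hwn, ← hw']
      simp
  rcases le_total z₂.im 0 with h | h
  · exact ⟨s₂, z₂, hlt, h, hpair z₂ hz₂ rfl⟩
  · refine ⟨s₂, starRingEnd ℂ z₂, hlt, by simpa using h, hpair _ ?_ ?_⟩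
    · rw [LFunction_conj hχ hr, hz₂, map_zero]
    · exact Complex.norm_ofReal_sub_conj _ _

/-- The point at which a zero `z` to the right of the critical line becomes as near as `ρ`. -/
noncomputable def crossing (ρ z : ℂ) : ℝ := (‖z‖ ^ 2 - ‖ρ‖ ^ 2) / (2 * z.re - 1)

/-- The quadratic terms in `s` cancel. The difference is affine and decreasing, so each zero to the
right overtakes `ρ` exactly once. -/
lemma norm_sub_sq_sub_norm_sub_sq {ρ z : ℂ} (hre : ρ.re = 1 / 2) (hz : 1 / 2 < z.re) (s : ℝ) :
    ‖(s : ℂ) - z‖ ^ 2 - ‖(s : ℂ) - ρ‖ ^ 2 = (2 * z.re - 1) * (crossing ρ z - s) := by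
  have h : 2 * z.re - 1 ≠ 0 := by linarith
  rw [crossing, mul_sub, mul_div_cancel₀ _ h, Complex.norm_ofReal_sub_sq, Complex.norm_ofReal_sub_sq,
    Complex.sq_norm, Complex.sq_norm, Complex.normSq_apply, Complex.normSq_apply, hre]
  ring

lemma norm_sub_lt_iff {ρ z : ℂ} (hre : ρ.re = 1 / 2) (hz : 1 / 2 < z.re) (s : ℝ) :
    ‖(s : ℂ) - ρ‖ < ‖(s : ℂ) - z‖ ↔ s < crossing ρ z := by
  have h := norm_sub_sq_sub_norm_sub_sq hre hz s
  have h1 : 0 < 2 * z.re - 1 := by linarith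
  rw [← sq_lt_sq₀ (norm_nonneg _) (norm_nonneg _), ← sub_pos, h, mul_pos_iff_of_pos_left h1, sub_pos]

lemma norm_sub_le_iff {ρ z : ℂ} (hre : ρ.re = 1 / 2) (hz : 1 / 2 < z.re) (s : ℝ) :
    ‖(s : ℂ) - ρ‖ ≤ ‖(s : ℂ) - z‖ ↔ s ≤ crossing ρ z := by
  have h := norm_sub_sq_sub_norm_sub_sq hre hz s
  have h1 : 0 < 2 * z.re - 1 := by linarith
  rw [← sq_le_sq₀ (norm_nonneg _) (norm_nonneg _), ← sub_nonneg, h, mul_nonneg_iff_of_pos_left h1,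
    sub_nonneg]

/-- Among the zeros to the right of the critical line, one crosses first. -/
lemma exists_first_crossing (hχ : χ ≠ 1) (hr : ∀ a, (χ a).im = 0) {ρ : ℂ}
    (hex : ∃ z, IsNontrivialZero χ z ∧ 1 / 2 < z.re) :
    ∃ z, IsNontrivialZero χ z ∧ 1 / 2 < z.re ∧ z.im ≤ 0 ∧
      ∀ w, IsNontrivialZero χ w → 1 / 2 < w.re → crossing ρ z ≤ crossing ρ w := by
  obtain ⟨z₀, hz₀, hz₀re⟩ := hex
  set A : Set ℂ := {z | (IsNontrivialZero χ z ∧ 1 / 2 < z.re) ∧ crossing ρ z ≤ crossing ρ z₀}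
    with hA
  have hfin : A.Finite := by
    -- As `0 < 2 Re z - 1 ≤ 1`, a bound for the crossing point bounds `‖z‖ ^ 2`.
    refine (finite_zeros_closedBall hχ (‖ρ‖ ^ 2 + |crossing ρ z₀| + 1)).subset ?_
    rintro z ⟨⟨h1, h2⟩, h3⟩
    refine ⟨h1.1, ?_⟩
    rw [mem_closedBall_zero_iff]
    have h4 : 0 < 2 * z.re - 1 := by linarith
    have h5 : 2 * z.re - 1 ≤ 1 := by linarith [h1.2.2]
    have h6 := h3.trans (le_abs_self _)
    rw [crossing, div_le_iff₀ h4] at h6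
    have h7 : |crossing ρ z₀| * (2 * z.re - 1) ≤ |crossing ρ z₀| :=
      mul_le_of_le_one_right (abs_nonneg _) h5
    nlinarith [sq_nonneg (‖z‖ - 1), sq_nonneg ‖ρ‖, abs_nonneg (crossing ρ z₀)]
  obtain ⟨z, ⟨⟨hz, hzre⟩, hzle⟩, hmin⟩ :=
    Set.exists_min_image A (crossing ρ) hfin ⟨z₀, ⟨hz₀, hz₀re⟩, le_rfl⟩
  have hall : ∀ w, IsNontrivialZero χ w → 1 / 2 < w.re → crossing ρ z ≤ crossing ρ w := by
    intro w hw hwre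
    rcases le_total (crossing ρ w) (crossing ρ z₀) with h | h
    · exact hmin w ⟨⟨hw, hwre⟩, h⟩
    · exact hzle.trans h
  rcases le_total z.im 0 with h | h
  · exact ⟨z, hz, hzre, h, hall⟩
  · refine ⟨starRingEnd ℂ z, isNontrivialZero_conj hχ hr hz, by simpa using hzre, by simpa using h,
      ?_⟩
    have : crossing ρ (starRingEnd ℂ z) = crossing ρ z := by simp [crossing]
    rw [this]
    exact hall

lemma riemannHypothesisFor_of_injOn (hp : χ.IsPrimitive) (hχ : χ ≠ 1) (hr : ∀ a, (χ a).im = 0)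
    {n D : ℝ} (hex : ∃ ρ, IsNontrivialZero χ ρ ∧ ‖ρ - 1 / 2‖ < n) (hD : n ^ 2 + 3 + n ≤ D)
    (hinj : Set.InjOn (signSeq χ) (Set.Ici (n ^ 2 + 2))) (hRH : RiemannHypothesisUpTo χ D) :
    RiemannHypothesisFor χ := by
  have hn : 0 < n := by
    obtain ⟨ρ, -, h⟩ := hex
    exact (norm_nonneg _).trans_lt h
  obtain ⟨ρ, hρ0, hre, hle, him, hlow⟩ := exists_lowest_zero hχ hr hex
    (fun z hz hzn => hRH z hz (hzn.trans (by nlinarith)))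
  set C := n ^ 2 + 2 with hC
  have hC2 : 2 ≤ C := by nlinarith
  have hdist : ∀ s : ℝ, 1 / 2 ≤ s → ‖(s : ℂ) - ρ‖ ≤ s + n := by
    intro s hs
    refine (Complex.norm_le_abs_re_add_abs_im _).trans ?_
    rw [Complex.sub_re, Complex.sub_im, Complex.ofReal_re, Complex.ofReal_im, hre,
      abs_of_nonneg (by linarith), zero_sub, abs_neg]
    linarith
  have hhigh : ∀ z, IsNontrivialZero χ z → 1 / 2 < z.re → D < |z.im| := by
    intro z hz hzre
    by_contra! h
    exact hzre.ne' (hRH z hz h)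
  -- The bound `D ≥ (C + 1) + n` is made for this: at `C + 1` the lowest zero is within `C + 1 + n`,
  -- while a zero off the line is farther than `D`.
  have hfar : ∀ z, IsNontrivialZero χ z → 1 / 2 < z.re → C + 1 < crossing ρ z := by
    intro z hz hzre
    rw [← norm_sub_lt_iff hre hzre]
    have h1 := hhigh z hz hzre
    have h2 := Complex.abs_im_le_norm (((C + 1 : ℝ) : ℂ) - z)
    rw [Complex.sub_im, Complex.ofReal_im, zero_sub, abs_neg] at h2
    have h3 := hdist (C + 1) (by linarith)
    linarith
  have hnear : ∀ s, C ≤ s → (∀ z, IsNontrivialZero χ z → 1 / 2 < z.re → s < crossing ρ z) →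
      IsNearestZero χ s ρ := fun s hs h =>
    isNearestZero_of_forall_lt hp hχ hr hρ0 hre him hlow hs fun z hz hzre =>
      (norm_sub_lt_iff hre hzre s).2 (h z hz hzre)
  -- If the lowest zero is `1/2` itself, it is seen under the angle `0` from both `C` and `C + 1`,
  -- against injectivity.
  rcases eq_or_lt_of_le hle with hzero | hneg
  · exfalso
    have harg : ∀ s : ℝ, C ≤ s → ((s : ℂ) - ρ).arg = Real.pi * (0 : ℕ) / (1 : ℕ) := by
      intro s hs
      rw [Complex.arg_eq_arctan_of_re_pos (by simp [hre]; linarith)]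
      simp [hzero]
    have h := (hnear C le_rfl fun z hz hzre => by linarith [hfar z hz hzre]).signSeq_eq hχ hr
      (hnear (C + 1) (by linarith) fun z hz hzre => hfar z hz hzre) (by linarith) (by linarith)
      odd_one (harg C le_rfl) (harg (C + 1) (by linarith))
    have := hinj (Set.mem_Ici.2 le_rfl) (Set.mem_Ici.2 (by linarith)) h
    linarith
  by_contra hnot
  have hex' : ∃ z, IsNontrivialZero χ z ∧ 1 / 2 < z.re := by
    simp only [RiemannHypothesisFor, not_forall] at hnot
    obtain ⟨z, hz, hzre⟩ := hnot
    obtain ⟨z', h1, h2, -⟩ := exists_re_gt_half_norm_le hp hχ hr hz hzre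
    exact ⟨z', h1, h2⟩
  obtain ⟨ρ₂, hρ₂, hρ₂re, hρ₂im, hfirst⟩ := exists_first_crossing hχ hr (ρ := ρ) hex'
  set s₀ := crossing ρ ρ₂ with hs₀
  have hCs₀ : C + 1 < s₀ := hfar ρ₂ hρ₂ hρ₂re
  have hρ₂im' : ρ₂.im < 0 := by
    refine lt_of_le_of_ne hρ₂im fun h => ?_
    have := hhigh ρ₂ hρ₂ hρ₂re
    rw [h, abs_zero] at this
    nlinarith
  have hρ₂lt := hρ₂.2.2
  have heq : ‖(s₀ : ℂ) - ρ₂‖ ^ 2 - ‖(s₀ : ℂ) - ρ‖ ^ 2 = 0 := by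
    rw [norm_sub_sq_sub_norm_sub_sq hre hρ₂re, ← hs₀, sub_self, mul_zero]
  have heq' : ‖(s₀ : ℂ) - ρ₂‖ = ‖(s₀ : ℂ) - ρ‖ :=
    (sq_eq_sq₀ (norm_nonneg _) (norm_nonneg _)).1 (by linarith)
  have hmin : ∀ z, χ.LFunction z = 0 → ‖(s₀ : ℂ) - ρ₂‖ ≤ ‖(s₀ : ℂ) - z‖ := by
    intro z hz
    rw [heq']
    rcases isNontrivialZero_or_of_LFunction_eq_zero hp hχ hr hz with h | h
    · by_cases hzre : z.re = 1 / 2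
      · rw [← sq_le_sq₀ (norm_nonneg _) (norm_nonneg _), Complex.norm_ofReal_sub_sq,
          Complex.norm_ofReal_sub_sq, hre, hzre, add_le_add_iff_left]
        exact sq_le_sq.2 (hlow z hz hzre)
      · obtain ⟨z', h1, h2, -, h3⟩ := exists_re_gt_half_norm_le hp hχ hr h hzre
        exact ((norm_sub_le_iff hre h2 s₀).2 (hfirst z' h1 h2)).trans (h3 s₀ (by linarith))
    · exact (norm_ofReal_sub_lt_of_trivial hre him (by linarith) h).le
  rw [Complex.norm_ofReal_sub_sq, Complex.norm_ofReal_sub_sq, hre] at heq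
  -- At equal distance from `s₀`, the zero with larger real part has larger height and is seen under
  -- the larger angle.
  have hθ : Real.arctan (-ρ.im / (s₀ - 1 / 2)) < Real.arctan (-ρ₂.im / (s₀ - ρ₂.re)) := by
    apply Real.arctan_strictMono
    refine div_lt_div₀ ?_ (by linarith) (by linarith) (by linarith)
    nlinarith
  have hθ' : Real.arctan (-ρ.im / (s₀ - 1 / 2)) < Real.arctan (-ρ.im / (C - 1 / 2)) := by
    apply Real.arctan_strictMono
    exact div_lt_div_of_pos_left (by linarith) (by linarith) (by linarith)
  obtain ⟨a, b, hb, hφ1, hφ2⟩ := exists_odd_pi_mul_div_mem_Ioo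
    (Real.arctan_nonneg.2 (div_nonneg (by linarith) (by linarith))) (lt_min hθ hθ')
  set φ := Real.pi * a / b with hφ
  have hφ0 : 0 < φ :=
    (Real.arctan_nonneg.2 (div_nonneg (by linarith) (by linarith))).trans_lt hφ1
  have hφpi : φ < Real.pi / 2 := (hφ2.trans_le (min_le_left _ _)).trans (Real.arctan_lt_pi_div_two _)
  have hpi := Real.pi_pos
  have htan : Real.arctan (Real.tan φ) = φ := Real.arctan_tan (by linarith) hφpi
  have htan0 : 0 < Real.tan φ := Real.tan_pos_of_pos_of_lt_pi_div_two hφ0 hφpi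
  -- The point from which `ρ` is seen under the angle `φ`. The bounds on `φ` place it in `[C, s₀)`,
  -- where `ρ` is still nearest.
  set s₁ := 1 / 2 + -ρ.im / Real.tan φ with hs₁
  have hs₁half : 0 < s₁ - 1 / 2 := by
    rw [hs₁, add_sub_cancel_left]
    exact div_pos (by linarith) htan0
  have hs₁tan : -ρ.im / (s₁ - 1 / 2) = Real.tan φ := by
    rw [hs₁, add_sub_cancel_left, div_div_cancel₀ (by linarith)]
  have harg₁ : ((s₁ : ℂ) - ρ).arg = φ := by
    rw [Complex.arg_eq_arctan_of_re_pos (by simpa [hre] using hs₁half), ← htan, ← hs₁tan]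
    simp [hre]
  have hs₁lt : s₁ < s₀ := by
    by_contra! h
    have : Real.arctan (-ρ.im / (s₁ - 1 / 2)) ≤ Real.arctan (-ρ.im / (s₀ - 1 / 2)) :=
      Real.arctan_strictMono.monotone
        (div_le_div_of_nonneg_left (by linarith) (by linarith) (by linarith))
    rw [hs₁tan, htan] at this
    linarith
  have hCs₁ : C ≤ s₁ := by
    by_contra! h
    have : Real.arctan (-ρ.im / (C - 1 / 2)) ≤ Real.arctan (-ρ.im / (s₁ - 1 / 2)) :=
      Real.arctan_strictMono.monotone
        (div_le_div_of_nonneg_left (by linarith) hs₁half (by linarith))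
    rw [hs₁tan, htan] at this
    linarith [min_le_right (Real.arctan (-ρ₂.im / (s₀ - ρ₂.re))) (Real.arctan (-ρ.im / (C - 1 / 2)))]
  have hnear₁ : IsNearestZero χ s₁ ρ := hnear s₁ hCs₁ fun z hz hzre =>
    hs₁lt.trans_le (hfirst z hz hzre)
  have hcos : (s₀ - ρ₂.re) / ‖(s₀ : ℂ) - ρ₂‖ < Real.cos φ := by
    have hre2 : ((s₀ : ℂ) - ρ₂).re = s₀ - ρ₂.re := by simp
    have h0 : (s₀ : ℂ) - ρ₂ ≠ 0 := fun h => by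
      rw [h, Complex.zero_re] at hre2
      linarith
    have h1 := Complex.cos_arg h0
    rw [hre2, Complex.arg_eq_arctan_of_re_pos (by rw [hre2]; linarith)] at h1
    rw [← h1]
    refine Real.cos_lt_cos_of_nonneg_of_le_pi hφ0.le ?_ ?_
    · linarith [Real.arctan_lt_pi_div_two (((s₀ : ℂ) - ρ₂).im / ((s₀ : ℂ) - ρ₂).re)]
    · simpa using hφ2.trans_le (min_le_left _ _)
  have hcos1 : Real.cos φ < 1 := by
    rw [← Real.cos_zero]
    exact Real.cos_lt_cos_of_nonneg_of_le_pi le_rfl (by linarith) hφ0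
  -- The zero found here need not be `ρ₂`, since further zeros may overtake; only the angle matters.
  obtain ⟨s₂, z₂, hs₂, hz₂, hnear₂, hcos₂⟩ :=
    exists_isNearestZero_cos_arg hχ hr (by linarith) hρ₂.1 hmin hcos hcos1
  have harg₂ : ((s₂ : ℂ) - z₂).arg = φ := by
    refine Real.injOn_cos ⟨Complex.arg_nonneg_iff.2 (by simpa using hz₂), Complex.arg_le_pi _⟩
      ⟨hφ0.le, by linarith⟩ hcos₂
  have h := hnear₁.signSeq_eq hχ hr hnear₂ (by linarith) (by linarith) hb harg₁ harg₂
  have := hinj (Set.mem_Ici.2 hCs₁) (Set.mem_Ici.2 (by linarith)) h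
  linarith

end DirichletCharacter

/-! ### The computable constants -/

theorem theorem2 :
    ∃ C D : List ℤ → ℕ, Computable C ∧ Computable D ∧
      ∀ (q : ℕ) [NeZero q] (χ : DirichletCharacter ℂ q),
        χ.IsPrimitive → χ ≠ 1 → (∀ a : ZMod q, (χ a).im = 0) →
          1 < C (valueTable χ) ∧
          (RiemannHypothesisFor χ → χ.LFunction (1 / 2) ≠ 0 →
            Set.InjOn (signSeq χ) (Set.Ici (C (valueTable χ) : ℝ))) ∧
          (Set.InjOn (signSeq χ) (Set.Ici (C (valueTable χ) : ℝ)) →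
            RiemannHypothesisUpTo χ (D (valueTable χ) : ℝ) →
              RiemannHypothesisFor χ) := by
  obtain ⟨N, hN⟩ := exists_isNontrivialZero_norm_lt
  have hlen : Primrec fun l : List ℤ => N + l.length :=
    Primrec.nat_add.comp (Primrec.const N) Primrec.list_length
  have hsq : Primrec fun l : List ℤ => (N + l.length) * (N + l.length) :=
    Primrec.nat_mul.comp hlen hlen
  -- With `n = N + q`, these are `C = n² + 2` and `D = n² + 3 + n`. `N` is a fixed number, and only
  -- the length `q` of the value table enters, so both are primitive recursive.
  refine ⟨fun l => (N + l.length) * (N + l.length) + 2,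
    fun l => (N + l.length) * (N + l.length) + 3 + (N + l.length),
    (Primrec.nat_add.comp hsq (Primrec.const 2)).to_comp,
    (Primrec.nat_add.comp (Primrec.nat_add.comp hsq (Primrec.const 3)) hlen).to_comp,
    fun q _ χ hp hχ hr => ?_⟩
  have hq : (valueTable χ).length = q := by simp [valueTable]
  have hex := hN q χ hp hχ hr
  have hC : (((N + q) * (N + q) + 2 : ℕ) : ℝ) = ((N + q : ℕ) : ℝ) ^ 2 + 2 := by
    push_cast; ring
  simp only [hq]
  rw [hC]
  refine ⟨by omega, fun hRH hhalf => DirichletCharacter.injOn_signSeq hp hχ hr hex hRH hhalf,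
    fun hinj hRH => DirichletCharacter.riemannHypothesisFor_of_injOn hp hχ hr hex ?_ hinj hRH⟩
  push_cast
  exact le_of_eq (by ring)
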